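/- Let $0<\alpha<1$, $\nu_1,\nu_2>0$, $\mu\in\mathbb{R}$, $\sigma>0$, and put $$K(\nu)=\frac{\Gamma((\nu+1)/2)}{\sqrt{\pi\nu}\,\Gamma(\nu/2)},\qquad B=\alpha K(\nu_1)+(1-\alpha)K(\nu_2),\qquad \alpha^*=\frac{\alpha K(\nu_1)}{B}.$$ Let $Y$ be a random variable having the asymmetric Student's $t$-distribution with location $\mu$ and scale $\sigma$, that is, with probability density function $$f(y)=\begin{cases}\dfrac1\sigma\Big[1+\dfrac1{\nu_1}\Big(\dfrac{y-\mu}{2\alpha\sigma K(\nu_1)}\Big)^2\Big]^{-(\nu_1+1)/2},& y\le\mu,\\[8pt]\dfrac1\sigma\Big[1+\dfrac1{\nu_2}\Big(\dfrac{y-\mu}{2(1-\alpha)\sigma K(\nu_2)}\Big)^2\Big]^{-(\nu_2+1)/2},& y>\mu,\end{cases}$$ and let $\phi_Y(t)=\mathbb{E}[\mathrm{e}^{\mathrm{i}tY}]$. Then, for all $t\in\mathbb{R}$, $$\phi_Y(t)=\mathrm{e}^{\mathrm{i}\mu t}\Big(\mathcal{A}_{\alpha,\nu_1}(\sigma Bt)+\mathcal{A}_{1-\alpha,\nu_2}(\sigma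 Bt)+\mathrm{i}\big\{\mathcal{B}_{1-\alpha,\nu_2}(\sigma Bt)-\mathcal{B}_{\alpha,\nu_1}(\sigma Bt)\big\}\Big).$$ Here, with $c=\alpha^*$ in $\mathcal{A}_{\alpha,\nu_1},\mathcal{B}_{\alpha,\nu_1}$ and $c=1-\alpha^*$ in $\mathcal{A}_{1-\alpha,\nu_2},\mathcal{B}_{1-\alpha,\nu_2}$, and for $\beta\in\{\alpha,1-\alpha\}$ and $x=2c\sqrt\nu\,|t|$: for $t\neq0$, $$\mathcal{A}_{\beta,\nu}(t)=\frac{2\beta\,(c\sqrt\nu|t|)^{\nu/2}K_{\nu/2}(x)}{\Gamma(\nu/2)},$$ and $\mathcal{A}_{\beta,\nu}(0)=\beta$, which is the limit of $\mathcal{A}_{\beta,\nu}(t)$ as $t\to0$ (this limit is part of the claim); for $t\ne0$ and $\nu\in(0,\infty)\setminus\{1,3,5,\ldots\}$, $$\mathcal{B}_{\beta,\nu}(t)=\frac{\pi\beta\,(c\sqrt\nu|t|)^{\nu/2}\,\mathrm{sgn}(t)}{\cos(\pi\nu/2)\,\Gamma(\nu/2)}\big\{I_{\nu/2}(x)-\mathbf{L}_{-\nu/2}(x)\big\};$$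 for $t\ne0$ and $\nu\in\{1,3,5,\ldots\}$, $$\mathcal{B}_{\beta,\nu}(t)=\frac{2\beta}{\sqrt\pi}\,\frac{\Gamma((\nu+1)/2)}{\Gamma(\nu/2)}\,\mathrm{sgn}(t)\sum_{k=1}^{(\nu+1)/2}\binom{\nu-k}{(\nu-1)/2}\frac{2^{k-\nu-1}}{(k-1)!}\Big\{x^{k-1}\big[\mathrm{e}^{-x}\mathrm{Ei}(x)+(-1)^k\mathrm{e}^{x}\mathrm{Ei}(-x)\big]-\sum_{j=1}^{k-1}(j-1)!\,[1+(-1)^{k+j}]\,x^{k-j-1}\Big\};$$ and $\mathcal{B}_{\beta,\nu}(0)=0$. Empty sums are zero, and $\mathrm{sgn}$ is the sign function. For $x>0$, $I_v(x)=\sum_{k\ge0}\frac{(x/2)^{2k+v}}{k!\,\Gamma(k+v+1)}$ and $K_v(x)=\int_0^\infty\mathrm{e}^{-x\cosh s}\cosh(vs)\,\mathrm{d}s$ are the modified Bessel functions of the first and second kind, and $\mathbf{L}_v(x)=\sum_{k\ge0}\frac{(x/2)^{2k+v+1}}{\Gamma(k+3/2)\,\Gamma(k+v+3/2)}$ is the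 modified Struve function of the first kind (with $1/\Gamma=0$ at the poles of $\Gamma$); $\mathrm{Ei}(x)=\mathrm{PV}\!\int_{-\infty}^x\frac{\mathrm{e}^s}{s}\,\mathrm{d}s$ for $x\neq0$ is the exponential integral. -/

import Mathlib

open Real Set Filter Topology MeasureTheory ProbabilityTheory

noncomputable section

namespace AST

/-! ### Special functions -/

/-- The modified Bessel function of the first kind `I_v(x)`, `x > 0`, by its power series.
(`1 / Γ` is `0` at the poles of `Γ`, in agreement with `Real.Gamma` being `0` there.) -/
def besselI (v x : ℝ) : ℝ :=
  ∑' k : ℕ, (x / 2) ^ (2 * (k : ℝ) + v) / ((Nat.factorial k : ℝ) * Real.Gamma (k + v + 1))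

/-- The modified Struve function of the first kind `L_v(x)`, `x > 0`, by its power series. -/
def struveL (v x : ℝ) : ℝ :=
  ∑' k : ℕ, (x / 2) ^ (2 * (k : ℝ) + v + 1) /
    (Real.Gamma (k + 3 / 2) * Real.Gamma (k + v + 3 / 2))

/-- The modified Bessel function of the second kind,
`K_v(x) = ∫_0^∞ exp (-x cosh s) cosh (v s) ds`, for `x > 0`. -/
def besselK (v x : ℝ) : ℝ :=
  ∫ s in Ioi (0 : ℝ), Real.exp (-x * Real.cosh s) * Real.cosh (v * s)

/-- The exponential integral `Ei(x) = PV ∫_{-∞}^x e^t / t dt`, for `x ≠ 0`. The principal value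
removes the interval `(-ε, ε)` and lets `ε` tend to `0` from above; for `x < 0` it is the ordinary
integral, so that `Ei(-y) = -∫_y^∞ e^{-t} / t dt` for `y > 0`. -/
def Ei (x : ℝ) : ℝ :=
  limUnder (𝓝[>] (0 : ℝ)) fun ε : ℝ => ∫ t in Iic x \ Ioo (-ε) ε, Real.exp t / t

/-! ### The asymmetric Student's t-distribution with location and scale -/

/-- `K(ν) = Γ((ν+1)/2) / (√(πν) Γ(ν/2))`. -/
def tConst (ν : ℝ) : ℝ :=
  Real.Gamma ((ν + 1) / 2) / (√(π * ν) * Real.Gamma (ν / 2))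

/-- `B = α K(ν₁) + (1 - α) K(ν₂)`. -/
def scaleB (α ν₁ ν₂ : ℝ) : ℝ := α * tConst ν₁ + (1 - α) * tConst ν₂

/-- `α* = α K(ν₁) / (α K(ν₁) + (1 - α) K(ν₂))`. -/
def alphaStar (α ν₁ ν₂ : ℝ) : ℝ :=
  α * tConst ν₁ / (α * tConst ν₁ + (1 - α) * tConst ν₂)

/-- The density of the AST distribution with location `μ` and scale `σ`. -/
def density (α ν₁ ν₂ μ σ y : ℝ) : ℝ :=
  if y ≤ μ then
    1 / σ * (1 + 1 / ν₁ * ((y - μ) / (2 * α * σ * tConst ν₁)) ^ 2) ^ (-(ν₁ + 1) / 2)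
  else
    1 / σ * (1 + 1 / ν₂ * ((y - μ) / (2 * (1 - α) * σ * tConst ν₂)) ^ 2) ^ (-(ν₂ + 1) / 2)

/-! ### The functions `𝒜` and `ℬ`

The argument `c` is the starred parameter that goes with `α`: it is `α*` for the pair `(α, ν₁)`
and `1 - α*` for the pair `(1 - α, ν₂)`. -/

/-- `𝒜_{α,ν}(t)`. As `K_{ν/2}` is infinite at `0`, the value at `t = 0` is the limit `α`. -/
def funA (α c ν t : ℝ) : ℝ :=
  if t = 0 then α
  else 2 * α * (c * √ν * |t|) ^ (ν / 2) * besselK (ν / 2) (2 * c * √ν * |t|) / Real.Gamma (ν / 2)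

/-- `ℬ_{α,ν}(t)` for `ν` not an odd positive integer. -/
def funBGeneric (α c ν t : ℝ) : ℝ :=
  π * α * (c * √ν * |t|) ^ (ν / 2) * Real.sign t / (Real.cos (π * ν / 2) * Real.Gamma (ν / 2)) *
    (besselI (ν / 2) (2 * c * √ν * |t|) - struveL (-(ν / 2)) (2 * c * √ν * |t|))

/-- `ℬ_{α,ν}(t)` for `ν = 2 n - 1`, `n` a positive integer. -/
def funBOdd (α c : ℝ) (n : ℕ) (t : ℝ) : ℝ :=
  let ν : ℝ := 2 * n - 1
  let x : ℝ := 2 * c * √ν * |t|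
  2 * α / √π * (Real.Gamma ((ν + 1) / 2) / Real.Gamma (ν / 2)) * Real.sign t *
    ∑ k ∈ Finset.Icc 1 n,
      ((2 * n - 1 - k).choose (n - 1) : ℝ) * ((2 : ℝ) ^ ((k : ℝ) - ν - 1) /
        (Nat.factorial (k - 1) : ℝ)) *
      (x ^ (k - 1) * (Real.exp (-x) * Ei x + (-1) ^ k * Real.exp x * Ei (-x)) -
        ∑ j ∈ Finset.Icc 1 (k - 1),
          (Nat.factorial (j - 1) : ℝ) * (1 + (-1) ^ (k + j)) * x ^ (k - j - 1))

open Classical in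
/-- `ℬ_{α,ν}(t)`. If `ν = 2 n - 1` for an integer `n ≥ 1`, then `n = ⌊(ν + 1) / 2⌋`. -/
def funB (α c ν t : ℝ) : ℝ :=
  if ∃ n : ℕ, 1 ≤ n ∧ ν = 2 * n - 1 then funBOdd α c ⌊(ν + 1) / 2⌋₊ t
  else funBGeneric α c ν t

end AST

end

namespace AST

/-! ### The entire functions `∑ z ^ k / (k! Γ (k + q))` -/

/-! On each side of `μ` the density is a rescaled copy of `(1 + u ^ 2) ^ (-a)` with `a = (ν + 1) /
2`, so the characteristic function is assembled from the half-line transforms `cosInt a` and `sinInt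
a` (`integral_Iic_density`, `integral_Ioi_density`). Since `α* B = α K(ν₁)` and `(1 - α*) B = (1 -
α) K(ν₂)`, the arguments agree with those of `𝒜` and `ℬ`, and everything rests on `funA_eq` and
`funB_eq`.

Writing `Γ(a) (1 + u ^ 2) ^ (-a)` as a Gamma integral in `s` reduces both transforms to those of a
Gaussian. The cosine transform of a Gaussian is a Gaussian, which leaves `macdonaldInt`, that is,
`K_{ν/2}` (`cosInt_eq`, `macdonaldInt_sq_div_four`). The half-line sine transform of a Gaussian is a
Dawson integral, so `sinInt` is an average of `macdonaldInt` of order `(ν - 1) / 2` over `w` in `(0,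
1)` (`sinInt_eq`).

If `ν` is not odd, this order is not an integer. The connection formula `macdonaldInt_eq_series`
then splits the integrand into two power series, and Beta integrals turn one into `I_{ν/2}` and the
other into `L_{-ν/2}` (`sinInt_eq_besselI_sub_struveL`).

If `ν` is odd, the connection formula degenerates, but `a` is a positive integer. The derivative of
`sinInt a` is expressed by `sinInt (a - 1)`, the case `a = 1` is a combination of exponential
integrals (`sinInt_one`), and induction gives the finite sum (`sinInt_natCast_add_one`). -/

theorem inv_Gamma_eq_mul_inv_Gamma_add_one (s : ℝ) : (Gamma s)⁻¹ = s * (Gamma (s + 1))⁻¹ := by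
  rcases eq_or_ne s 0 with rfl | hs
  -- `Real.Gamma` is `0` at its poles, so its inverse is the entire function `1 / Γ` there too; no
  -- recurrence below has to exclude values of `q`.
  · simp
  · rw [Gamma_add_one hs, mul_inv, mul_inv_cancel_left₀ hs]

theorem summable_pow_div_Gamma_mul_Gamma (p q z : ℝ) :
    Summable fun k : ℕ => z ^ k / (Gamma (k + p) * Gamma (k + q)) := by
  rcases eq_or_ne z 0 with rfl | hz
  · refine summable_of_ne_finset_zero (s := {0}) fun k hk => ?_
    simp at hk
    simp [hk]
  have hpos : ∀ r : ℝ, ∀ᶠ k : ℕ in atTop, 0 < (k : ℝ) + r := fun r =>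
    (tendsto_atTop_add_const_right _ r tendsto_natCast_atTop_atTop).eventually_gt_atTop 0
  refine summable_of_ratio_test_tendsto_lt_one (l := 0) one_pos ?_ ?_
  · filter_upwards [hpos p, hpos q] with k h1 h2
    have := Gamma_pos_of_pos h1
    have := Gamma_pos_of_pos h2
    positivity
  · have h1 : Tendsto (fun k : ℕ => |z| * (((k : ℝ) + p)⁻¹ * ((k : ℝ) + q)⁻¹)) atTop (𝓝 0) := by
      have h : ∀ r : ℝ, Tendsto (fun k : ℕ => ((k : ℝ) + r)⁻¹) atTop (𝓝 0) := fun r =>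
        (tendsto_atTop_add_const_right _ r tendsto_natCast_atTop_atTop).inv_tendsto_atTop
      simpa using ((h p).mul (h q)).const_mul |z|
    refine h1.congr' ?_
    filter_upwards [hpos p, hpos q] with k h1 h2
    have g1 := Gamma_pos_of_pos h1
    have g2 := Gamma_pos_of_pos h2
    have e1 : Gamma (((k + 1 : ℕ) : ℝ) + p) = (k + p) * Gamma (k + p) := by
      rw [← Gamma_add_one h1.ne']; push_cast; ring_nf
    have e2 : Gamma (((k + 1 : ℕ) : ℝ) + q) = (k + q) * Gamma (k + q) := by
      rw [← Gamma_add_one h2.ne']; push_cast; ring_nf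
    rw [e1, e2]
    simp only [norm_div, norm_mul, norm_pow, Real.norm_eq_abs, abs_of_pos g1, abs_of_pos g2,
      abs_of_pos h1, abs_of_pos h2, pow_succ]
    have : 0 < |z| := abs_pos.2 hz
    field_simp

/-- The entire function `∑ z ^ k / (k! Γ (k + q))`, a rescaled modified Bessel function. -/
noncomputable def besselClifford (q z : ℝ) : ℝ :=
  ∑' k : ℕ, z ^ k / ((Nat.factorial k : ℝ) * Gamma (k + q))

theorem summable_besselClifford (q z : ℝ) :
    Summable fun k : ℕ => z ^ k / ((Nat.factorial k : ℝ) * Gamma (k + q)) := by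
  simpa [Gamma_nat_eq_factorial] using summable_pow_div_Gamma_mul_Gamma 1 q z

theorem besselClifford_zero (q : ℝ) : besselClifford q 0 = (Gamma q)⁻¹ := by
  rw [besselClifford, tsum_eq_single 0 fun k hk => by simp [hk]]
  simp

/-- Termwise differentiation: the factor `k` cancels in `k!`, and the index shift raises `q` by one.
The series at `|z| + 1` dominates the derivatives near `z`. -/
theorem hasDerivAt_besselClifford (q z : ℝ) :
    HasDerivAt (besselClifford q) (besselClifford (q + 1) z) z := by
  have hterm : ∀ (y : ℝ) (k : ℕ), ((k + 1 : ℕ) * y ^ (k + 1 - 1)) /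
      ((Nat.factorial (k + 1) : ℝ) * Gamma ((k + 1 : ℕ) + q)) =
        y ^ k / ((Nat.factorial k : ℝ) * Gamma (k + (q + 1))) := by
    intro y k
    rw [Nat.factorial_succ, Nat.add_sub_cancel]
    push_cast
    rw [show (k : ℝ) + 1 + q = k + (q + 1) by ring, mul_assoc,
      mul_div_mul_left _ _ (by positivity)]
  have hs : ∀ y : ℝ, Summable fun k : ℕ =>
      (k * y ^ (k - 1)) / ((Nat.factorial k : ℝ) * Gamma (k + q)) := by
    intro y
    rw [← summable_nat_add_iff 1]
    exact (summable_besselClifford (q + 1) y).congr fun k => (hterm y k).symm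
  have hsum : ∑' k : ℕ, (k * z ^ (k - 1)) / ((Nat.factorial k : ℝ) * Gamma (k + q)) =
      besselClifford (q + 1) z := by
    rw [(hs z).tsum_eq_zero_add, besselClifford]
    simp only [Nat.cast_zero, zero_mul, zero_div, zero_add]
    exact tsum_congr fun k => hterm z k
  rw [← hsum]
  refine hasDerivAt_tsum_of_isPreconnected (𝕜 := ℝ) (F := ℝ)
    (g := fun (k : ℕ) y => y ^ k / ((Nat.factorial k : ℝ) * Gamma (k + q)))
    (g' := fun (k : ℕ) y => (k * y ^ (k - 1)) / ((Nat.factorial k : ℝ) * Gamma (k + q)))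
    (t := Metric.ball 0 (|z| + 1)) (y₀ := z) (y := z) (hs (|z| + 1)).abs Metric.isOpen_ball
    (convex_ball _ _).isPreconnected (fun n y _ => (hasDerivAt_pow n y).div_const _)
    (fun n y hy => ?_) (by simp) (summable_besselClifford q z) (by simp)
  rw [Real.norm_eq_abs, abs_div, abs_div]
  simp only [abs_mul, abs_pow]
  have : |y| ≤ |(|z| + 1)| := by
    rw [abs_of_pos (by positivity : 0 < |z| + 1)]
    exact (by simpa using hy : |y| < |z| + 1).le
  gcongr

theorem continuous_besselClifford (q : ℝ) : Continuous (besselClifford q) :=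
  continuous_iff_continuousAt.2 fun z => (hasDerivAt_besselClifford q z).continuousAt

/-- The three-term relation of the functions `besselClifford q`. -/
theorem besselClifford_eq_add (q z : ℝ) :
    besselClifford q z = q * besselClifford (q + 1) z + z * besselClifford (q + 2) z := by
  have h1 := summable_besselClifford (q + 1) z
  have h2 := summable_besselClifford (q + 2) z
  have h3 : Summable fun k : ℕ => k * z ^ k / ((Nat.factorial k : ℝ) * Gamma (k + (q + 1))) := by
    rw [← summable_nat_add_iff 1]
    refine (h2.mul_left z).congr fun k => ?_
    rw [Nat.factorial_succ]
    push_cast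
    rw [show (k : ℝ) + 1 + (q + 1) = k + (q + 2) by ring, mul_assoc ((k : ℝ) + 1),
      mul_div_mul_left _ _ (by positivity)]
    ring
  have h4 : z * besselClifford (q + 2) z =
      ∑' k : ℕ, k * z ^ k / ((Nat.factorial k : ℝ) * Gamma (k + (q + 1))) := by
    rw [h3.tsum_eq_zero_add, besselClifford, ← tsum_mul_left]
    simp only [Nat.cast_zero, zero_mul, zero_div, zero_add]
    refine tsum_congr fun k => ?_
    rw [Nat.factorial_succ]
    push_cast
    rw [show (k : ℝ) + 1 + (q + 1) = k + (q + 2) by ring, mul_assoc ((k : ℝ) + 1),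
      mul_div_mul_left _ _ (by positivity)]
    ring
  rw [h4, besselClifford, besselClifford, ← tsum_mul_left, ← (h1.mul_left q).tsum_add h3]
  refine tsum_congr fun k => ?_
  -- Since `1 / Γ(k + q) = (k + q) / Γ(k + q + 1)`, the summand `q` gives the first series on the
  -- right and the summand `k` the second.
  rw [div_eq_mul_inv, mul_inv, inv_Gamma_eq_mul_inv_Gamma_add_one, ← add_assoc (k : ℝ) q 1]
  simp only [div_eq_mul_inv, mul_inv]
  ring

theorem besselClifford_pos {q z : ℝ} (hq : 0 < q) (hz : 0 ≤ z) : 0 < besselClifford q z := by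
  have hG : ∀ k : ℕ, 0 < Gamma (k + q) := fun k => Gamma_pos_of_pos (by positivity)
  refine (summable_besselClifford q z).tsum_pos (fun k => ?_) 0 ?_
  · have := hG k
    positivity
  · have := hG 0
    simp at this ⊢
    exact this

/-- A function on the positive half-line with zero derivative and limit `0` at `0` vanishes. -/
theorem eq_zero_of_hasDerivAt_zero (g : ℝ → ℝ) (hg : ∀ y, 0 < y → HasDerivAt g 0 y)
    (hl : Tendsto g (𝓝[>] 0) (𝓝 0)) (y : ℝ) (hy : 0 < y) : g y = 0 := by
  have hc : ∀ x ∈ Ioi (0 : ℝ), g x = g y := fun x hx =>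
    isOpen_Ioi.is_const_of_deriv_eq_zero isPreconnected_Ioi
      (fun x hx => (hg x hx).differentiableAt.differentiableWithinAt)
      (fun x hx => (hg x hx).deriv) hx hy
  exact tendsto_nhds_unique ((tendsto_const_nhds (x := g y)).congr'
    (by filter_upwards [self_mem_nhdsWithin] with x hx using (hc x hx).symm)) hl

/-! ### The integral `∫_0^∞ s ^ (v - 1) exp (-s - z / s) ds` -/

/-- The integral `∫_0^∞ s ^ (v - 1) exp (-s - z / s) ds = 2 z ^ (v / 2) K_v (2 √z)`. -/
noncomputable def macdonaldInt (v z : ℝ) : ℝ :=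
  ∫ s in Ioi (0 : ℝ), s ^ (v - 1) * exp (-s - z / s)

/-- At `0` the factor `exp (-z / s)` is bounded by a multiple of `s ^ n` for every `n`; taking `n >
-v` leaves a convergent Gamma integrand. -/
theorem integrableOn_macdonaldInt (v : ℝ) {z : ℝ} (hz : 0 < z) :
    IntegrableOn (fun s : ℝ => s ^ (v - 1) * exp (-s - z / s)) (Ioi 0) := by
  obtain ⟨n, hn⟩ := exists_nat_gt (-v)
  have hvn : 0 < v + n := by linarith
  refine ((GammaIntegral_convergent hvn).const_mul (n.factorial / z ^ n)).mono' (by fun_prop) ?_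
  refine (ae_restrict_iff' measurableSet_Ioi).2 (ae_of_all _ fun s (hs : 0 < s) => ?_)
  rw [Real.norm_eq_abs, abs_of_nonneg (by positivity), sub_eq_add_neg (-s), exp_add,
    exp_neg (z / s)]
  have h1 : (z / s) ^ n / n.factorial ≤ exp (z / s) := pow_div_factorial_le_exp _ (by positivity) n
  have h2 : (exp (z / s))⁻¹ ≤ n.factorial / z ^ n * s ^ n := by
    calc (exp (z / s))⁻¹ ≤ ((z / s) ^ n / n.factorial)⁻¹ := by gcongr
      _ = n.factorial / z ^ n * s ^ n := by rw [div_pow]; field_simp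
  calc s ^ (v - 1) * (exp (-s) * (exp (z / s))⁻¹)
      ≤ s ^ (v - 1) * (exp (-s) * (n.factorial / z ^ n * s ^ n)) := by gcongr
    _ = n.factorial / z ^ n * (exp (-s) * s ^ (v + n - 1)) := by
      rw [show v + n - 1 = (v - 1) + n by ring, rpow_add hs, rpow_natCast]; ring

theorem hasDerivAt_macdonaldInt (v : ℝ) {z : ℝ} (hz : 0 < z) :
    HasDerivAt (macdonaldInt v) (-macdonaldInt (v - 1) z) z := by
  have key := (hasDerivAt_integral_of_dominated_loc_of_deriv_le (μ := volume.restrict (Ioi (0 : ℝ)))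
    (F := fun z s => s ^ (v - 1) * exp (-s - z / s))
    (F' := fun z s => -(s ^ (v - 1 - 1) * exp (-s - z / s)))
    (bound := fun s => s ^ (v - 1 - 1) * exp (-s - (z / 2) / s)) (x₀ := z)
    (Ioi_mem_nhds (half_lt_self hz)) (Eventually.of_forall fun y => by fun_prop)
    (integrableOn_macdonaldInt v hz) (by fun_prop) ?_
    (integrableOn_macdonaldInt (v - 1) (half_pos hz)) ?_).2
  · rw [integral_neg] at key
    exact key
  · refine (ae_restrict_iff' measurableSet_Ioi).2 (ae_of_all _ fun s (hs : 0 < s) y hy => ?_)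
    rw [norm_neg, Real.norm_eq_abs, abs_of_nonneg (by positivity)]
    have : z / 2 < y := hy
    gcongr
  · refine (ae_restrict_iff' measurableSet_Ioi).2 (ae_of_all _ fun s (hs : 0 < s) y hy => ?_)
    have := (((hasDerivAt_id y).div_const s).const_sub (-s)).exp.const_mul (s ^ (v - 1))
    refine this.congr_deriv ?_
    simp only [id]
    rw [rpow_sub_one hs.ne' (v - 1)]
    ring

/-- The reflection `v ↦ -v`, from the substitution `s ↦ z / s`. -/
theorem macdonaldInt_eq_rpow_mul_neg (v : ℝ) {z : ℝ} (hz : 0 < z) :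
    macdonaldInt v z = z ^ v * macdonaldInt (-v) z := by
  -- The substitution is carried out as the inversion `s ↦ 1 / s` followed by a scaling by `1 / z`.
  have h1 := integral_comp_rpow_Ioi (fun s : ℝ => s ^ (v - 1) * exp (-s - z / s))
    (p := -1) (by norm_num)
  have h2 := integral_comp_mul_left_Ioi
    (fun s : ℝ => (|(-1 : ℝ)| * s ^ ((-1 : ℝ) - 1)) •
      ((s ^ (-1 : ℝ)) ^ (v - 1) * exp (-s ^ (-1 : ℝ) - z / s ^ (-1 : ℝ)))) 0 (inv_pos.2 hz)
  rw [mul_zero, h1, inv_inv, smul_eq_mul] at h2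
  rw [macdonaldInt, ← mul_right_inj' hz.ne', ← h2, macdonaldInt, ← mul_assoc,
    ← integral_const_mul]
  refine setIntegral_congr_fun measurableSet_Ioi fun s (hs : 0 < s) => ?_
  have e1 : (z⁻¹ * s) ^ (-1 : ℝ) = z / s := by
    rw [rpow_neg_one]; field_simp
  have e2 : (z⁻¹ * s) ^ ((-1 : ℝ) - 1) = z ^ 2 / s ^ 2 := by
    rw [show (-1 : ℝ) - 1 = -(2 : ℕ) by norm_num, rpow_neg (by positivity), rpow_natCast]
    field_simp
  simp only [smul_eq_mul]
  rw [e1, e2, div_rpow hz.le hs.le, rpow_sub_one hz.ne', rpow_sub_one hs.ne', rpow_sub_one hs.ne',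
    rpow_neg hs.le, show -(z / s) - z / (z / s) = -s - z / s by field_simp; ring]
  simp only [abs_neg, abs_one, one_mul]
  field_simp

/-- Differentiating the reflection formula gives a second expression for the derivative; comparing
it with `hasDerivAt_macdonaldInt` yields the recurrence. -/
theorem mul_macdonaldInt_sub_one (v : ℝ) {z : ℝ} (hz : 0 < z) :
    z * macdonaldInt (v - 1) z = macdonaldInt (v + 1) z - v * macdonaldInt v z := by
  have h1 := hasDerivAt_macdonaldInt v hz
  have h2 := (hasDerivAt_rpow_const (p := v) (Or.inl hz.ne')).mul
    (hasDerivAt_macdonaldInt (-v) hz)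
  have h3 := h1.unique (h2.congr_of_eventuallyEq (by
    filter_upwards [Ioi_mem_nhds hz] with y hy
    exact macdonaldInt_eq_rpow_mul_neg v hy))
  rw [macdonaldInt_eq_rpow_mul_neg (v + 1) hz, macdonaldInt_eq_rpow_mul_neg v hz,
    rpow_add_one hz.ne', neg_add]
  rw [rpow_sub_one hz.ne'] at h3
  have h4 : macdonaldInt (v - 1) z =
      -(v * (z ^ v / z) * macdonaldInt (-v) z + z ^ v * -macdonaldInt (-v - 1) z) := by
    linarith
  rw [h4, ← sub_eq_add_neg (-v) 1]
  field_simp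
  ring

theorem macdonaldInt_zero (v : ℝ) (hv : 0 < v) : macdonaldInt v 0 = Gamma v := by
  rw [macdonaldInt, Gamma_eq_integral hv]
  simp [mul_comm]

theorem continuousWithinAt_macdonaldInt_zero {v : ℝ} (hv : 0 < v) :
    ContinuousWithinAt (macdonaldInt v) (Ici 0) 0 := by
  refine continuousWithinAt_of_dominated (bound := fun s => exp (-s) * s ^ (v - 1))
    (Eventually.of_forall fun y => by fun_prop) ?_ (GammaIntegral_convergent hv) ?_
  · filter_upwards [self_mem_nhdsWithin] with y hy
    refine (ae_restrict_iff' measurableSet_Ioi).2 (ae_of_all _ fun s (hs : 0 < s) => ?_)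
    rw [Real.norm_eq_abs, abs_of_nonneg (by positivity), mul_comm]
    have : 0 ≤ y / s := div_nonneg hy hs.le
    gcongr
    linarith
  · exact ae_of_all _ fun s => Continuous.continuousWithinAt (by fun_prop)

theorem tendsto_macdonaldInt_zero {v : ℝ} (hv : 0 < v) :
    Tendsto (macdonaldInt v) (𝓝[>] 0) (𝓝 (Gamma v)) := by
  rw [← macdonaldInt_zero v hv]
  exact (continuousWithinAt_macdonaldInt_zero hv).mono Ioi_subset_Ici_self

/-! ### The connection formula -/

/-- The power series side of the connection formula between the modified Bessel functions. -/
noncomputable def macdonaldSeries (v z : ℝ) : ℝ :=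
  π / sin (π * v) * (besselClifford (1 - v) z - z ^ v * besselClifford (1 + v) z)

/-- Reflection exchanges the two series, and the sine changes sign. At integer `v` the prefactor is
`π / 0 = 0`, so this and the next relations hold there trivially. -/
theorem macdonaldSeries_eq_rpow_mul_neg (v : ℝ) {z : ℝ} (hz : 0 < z) :
    macdonaldSeries v z = z ^ v * macdonaldSeries (-v) z := by
  have : z ^ v ≠ 0 := (rpow_pos_of_pos hz v).ne'
  rw [macdonaldSeries, macdonaldSeries, mul_neg, sin_neg, rpow_neg hz.le, sub_neg_eq_add,
    ← sub_eq_add_neg, div_neg]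
  field_simp
  ring

theorem sin_pi_mul_sub_one (v : ℝ) : sin (π * (v - 1)) = -sin (π * v) := by
  rw [mul_sub, mul_one, sin_sub_pi]

theorem hasDerivAt_macdonaldSeries (v : ℝ) {z : ℝ} (hz : 0 < z) :
    HasDerivAt (macdonaldSeries v) (-macdonaldSeries (v - 1) z) z := by
  have h := ((hasDerivAt_besselClifford (1 - v) z).sub
    ((hasDerivAt_rpow_const (p := v) (Or.inl hz.ne')).mul
      (hasDerivAt_besselClifford (1 + v) z))).const_mul (π / sin (π * v))
  refine h.congr_deriv ?_
  rw [macdonaldSeries, sin_pi_mul_sub_one, show 1 - (v - 1) = 1 - v + 1 by ring,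
    show 1 + (v - 1) = v by ring, besselClifford_eq_add v z, rpow_sub_one hz.ne',
    add_comm 1 v, show v + 1 + 1 = v + 2 by ring, div_neg]
  field_simp

theorem mul_macdonaldSeries_sub_one (v : ℝ) {z : ℝ} (hz : 0 < z) :
    z * macdonaldSeries (v - 1) z = macdonaldSeries (v + 1) z - v * macdonaldSeries v z := by
  have h1 := hasDerivAt_macdonaldSeries v hz
  have h2 := (hasDerivAt_rpow_const (p := v) (Or.inl hz.ne')).mul
    (hasDerivAt_macdonaldSeries (-v) hz)
  have h3 := h1.unique (h2.congr_of_eventuallyEq (by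
    filter_upwards [Ioi_mem_nhds hz] with y hy
    exact macdonaldSeries_eq_rpow_mul_neg v hy))
  rw [macdonaldSeries_eq_rpow_mul_neg (v + 1) hz, macdonaldSeries_eq_rpow_mul_neg v hz,
    rpow_add_one hz.ne', neg_add]
  rw [rpow_sub_one hz.ne'] at h3
  have h4 : macdonaldSeries (v - 1) z =
      -(v * (z ^ v / z) * macdonaldSeries (-v) z + z ^ v * -macdonaldSeries (-v - 1) z) := by
    linarith
  rw [h4, ← sub_eq_add_neg (-v) 1]
  field_simp
  ring

theorem tendsto_macdonaldSeries_zero {v : ℝ} (hv₀ : 0 < v) (hv₁ : v < 1) :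
    Tendsto (macdonaldSeries v) (𝓝[>] 0) (𝓝 (Gamma v)) := by
  have h : ContinuousAt (macdonaldSeries v) 0 :=
    (((continuous_besselClifford _).continuousAt).sub
      ((continuousAt_rpow_const _ _ (Or.inr hv₀.le)).mul
        (continuous_besselClifford _).continuousAt)).const_mul _
  have h0 : macdonaldSeries v 0 = Gamma v := by
    have hG : Gamma (1 - v) ≠ 0 := (Gamma_pos_of_pos (by linarith)).ne'
    rw [macdonaldSeries, besselClifford_zero, zero_rpow hv₀.ne', zero_mul, sub_zero,
      ← Gamma_mul_Gamma_one_sub, mul_inv_cancel_right₀ hG]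
  rw [← h0]
  exact h.mono_left nhdsWithin_le_nhds

/-- Both sides obey the same derivative and reflection rules, so their difference `d v` solves the
same second-order equation as `P = besselClifford (1 - v)`. By Abel's identity the weighted
Wronskian `w` is constant, and it tends to `0` at `0`. Up to a nonvanishing factor `w` is the
derivative of `d v / P`, so this quotient is constant, and it also tends to `0`. -/
theorem macdonaldInt_eq_series_of_lt_one {v : ℝ} (hv₀ : 0 < v) (hv₁ : v < 1) {z : ℝ}
    (hz : 0 < z) : macdonaldInt v z = macdonaldSeries v z := by
  set d : ℝ → ℝ → ℝ := fun v z => macdonaldInt v z - macdonaldSeries v z with hd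
  have d_deriv : ∀ (v : ℝ) {z : ℝ}, 0 < z → HasDerivAt (d v) (-d (v - 1) z) z := fun v z hz =>
    ((hasDerivAt_macdonaldInt v hz).sub (hasDerivAt_macdonaldSeries v hz)).congr_deriv
      (by simp only [hd]; ring)
  have d_refl : ∀ (v : ℝ) {z : ℝ}, 0 < z → d v z = z ^ v * d (-v) z := fun v z hz => by
    simp only [hd]
    rw [macdonaldInt_eq_rpow_mul_neg v hz, macdonaldSeries_eq_rpow_mul_neg v hz, mul_sub]
  have d_lim : ∀ {v : ℝ}, 0 < v → v < 1 → Tendsto (d v) (𝓝[>] 0) (𝓝 0) := fun {v} h0 h1 => by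
    simpa using (tendsto_macdonaldInt_zero h0).sub (tendsto_macdonaldSeries_zero h0 h1)
  set w : ℝ → ℝ := fun z => d (1 - v) z * besselClifford (1 - v) z +
    z ^ (1 - v) * (d v z * besselClifford (1 - v + 1) z) with hw
  have hcont : ∀ q, Tendsto (besselClifford q) (𝓝[>] 0) (𝓝 (besselClifford q 0)) := fun q =>
    (continuous_besselClifford q).continuousAt.mono_left nhdsWithin_le_nhds
  have w_zero : ∀ y, 0 < y → w y = 0 := by
    refine eq_zero_of_hasDerivAt_zero w (fun y hy => ?_) ?_
    · have h1 := ((d_deriv (1 - v) hy).mul (hasDerivAt_besselClifford (1 - v) y)).add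
        ((hasDerivAt_rpow_const (p := 1 - v) (Or.inl hy.ne')).mul
          ((d_deriv v hy).mul (hasDerivAt_besselClifford (1 - v + 1) y)))
      refine h1.congr_deriv ?_
      have e1 := d_refl v hy
      have e2 := d_refl (1 - v) hy
      have e3 := besselClifford_eq_add (1 - v) y
      rw [show 1 - v - 1 = -v by ring] at *
      rw [show -(1 - v) = v - 1 by ring] at e2
      rw [show 1 - v + 1 + 1 = 1 - v + 2 by ring, e2, e1, e3]
      have e4 : y ^ (1 - v) = y * (y ^ v)⁻¹ := by
        rw [rpow_sub hy, rpow_one]; rfl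
      have e5 : y ^ (-v) = (y ^ v)⁻¹ := rpow_neg hy.le v
      have : y ^ v ≠ 0 := (rpow_pos_of_pos hy v).ne'
      simp only [Pi.mul_apply]
      rw [e4, e5, e1]
      field_simp
      ring
    · have h1 := (d_lim (v := 1 - v) (by linarith) (by linarith)).mul (hcont (1 - v))
      have h2 : Tendsto (fun y : ℝ => y ^ (1 - v)) (𝓝[>] 0) (𝓝 (0 ^ (1 - v))) :=
        (continuousAt_rpow_const _ _ (Or.inr (by linarith))).mono_left nhdsWithin_le_nhds
      have h3 := h1.add (h2.mul ((d_lim hv₀ hv₁).mul (hcont (1 - v + 1))))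
      simpa using h3
  have hP : ∀ y, 0 ≤ y → 0 < besselClifford (1 - v) y := fun y hy =>
    besselClifford_pos (by linarith) hy
  have hq := eq_zero_of_hasDerivAt_zero (fun y => d v y / besselClifford (1 - v) y) (fun y hy => ?_) ?_ z hz
  · have := (div_eq_zero_iff.1 hq).resolve_right (hP z hz.le).ne'
    exact sub_eq_zero.1 this
  · refine ((d_deriv v hy).div (hasDerivAt_besselClifford (1 - v) y) (hP y hy.le).ne').congr_deriv ?_
    have e1 := w_zero y hy
    have e2 := d_refl (1 - v) hy
    rw [show -(1 - v) = v - 1 by ring] at e2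
    simp only [hw] at e1
    rw [e2, mul_assoc, ← mul_add] at e1
    have e3 := (mul_eq_zero.1 e1).resolve_left (rpow_pos_of_pos hy _).ne'
    rw [div_eq_zero_iff]
    left
    linarith
  · have h := (d_lim hv₀ hv₁).div (hcont (1 - v)) (hP 0 le_rfl).ne'
    rwa [zero_div] at h

/-- The three-term recurrence is common to both sides. It climbs from the orders `v - 1` and `v`
with `0 < v < 1`, the former being the reflection of `1 - v`; negative orders follow by reflection.
-/
theorem macdonaldInt_eq_series {v : ℝ} (hv : ∀ n : ℤ, v ≠ n) {z : ℝ} (hz : 0 < z) :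
    macdonaldInt v z = macdonaldSeries v z := by
  have hpos : ∀ (n : ℕ) (v : ℝ), 0 < v → v < 1 →
      macdonaldInt (v + n) z = macdonaldSeries (v + n) z ∧
        macdonaldInt (v + n - 1) z = macdonaldSeries (v + n - 1) z := by
    intro n v h0 h1
    induction n with
    | zero =>
      have e1 := macdonaldInt_eq_series_of_lt_one h0 h1 hz
      have e2 := macdonaldInt_eq_series_of_lt_one (v := 1 - v) (by linarith) (by linarith) hz
      rw [macdonaldInt_eq_rpow_mul_neg _ hz, macdonaldSeries_eq_rpow_mul_neg _ hz, neg_sub] at e2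
      simpa [e1] using mul_left_cancel₀ (rpow_pos_of_pos hz _).ne' e2
    | succ n ih =>
      have e1 := mul_macdonaldInt_sub_one (v + n) hz
      have e2 := mul_macdonaldSeries_sub_one (v + n) hz
      rw [ih.1, ih.2] at e1
      push_cast
      rw [show v + (n + 1 : ℝ) = v + n + 1 by ring, add_sub_cancel_right]
      exact ⟨by linarith, ih.1⟩
  have hfr : ∀ v : ℝ, (∀ n : ℤ, v ≠ n) → 0 < v → macdonaldInt v z = macdonaldSeries v z := by
    intro v hv h0
    have h1 : 0 < Int.fract v := (Int.fract_pos).2 fun h => hv _ h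
    have h2 := (hpos ⌊v⌋₊ _ h1 (Int.fract_lt_one v)).1
    have h3 : Int.fract v + (⌊v⌋₊ : ℝ) = v := by
      rw [natCast_floor_eq_intCast_floor h0.le, Int.fract_add_floor]
    rwa [h3] at h2
  rcases lt_trichotomy v 0 with h | h | h
  · rw [macdonaldInt_eq_rpow_mul_neg _ hz, macdonaldSeries_eq_rpow_mul_neg _ hz,
      hfr (-v) (fun n hn => hv (-n) (by push_cast; linarith)) (by linarith)]
  · exact absurd h (by simpa using hv 0)
  · exact hfr v hv h

/-! ### Modified Bessel function of the second kind -/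

/-- The substitution `s = (x / 2) exp τ` makes the exponent `-x cosh τ`; folding `τ` and `-τ`
together turns `exp (v τ)` into `2 cosh (v τ)`. -/
theorem macdonaldInt_sq_div_four (v : ℝ) {x : ℝ} (hx : 0 < x) :
    macdonaldInt v (x ^ 2 / 4) = 2 * (x / 2) ^ v * besselK v x := by
  set g : ℝ → ℝ := fun τ => exp (v * τ) * exp (-x * cosh τ) with hg
  have himg : (fun τ : ℝ => x / 2 * exp τ) '' univ = Ioi 0 := by
    ext s
    simp only [image_univ, mem_range, mem_Ioi]
    constructor
    · rintro ⟨τ, rfl⟩; positivity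
    · intro hs
      refine ⟨log (s / (x / 2)), ?_⟩
      rw [exp_log (by positivity)]
      field_simp
  have hder : ∀ τ ∈ (univ : Set ℝ),
      HasDerivWithinAt (fun τ : ℝ => x / 2 * exp τ) (x / 2 * exp τ) univ τ := fun τ _ =>
    ((hasDerivAt_exp τ).const_mul _).hasDerivWithinAt
  have hinj : InjOn (fun τ : ℝ => x / 2 * exp τ) univ := fun a _ b _ hab =>
    exp_injective (mul_left_cancel₀ (by positivity : x / 2 ≠ 0) hab)
  have hpt : (fun τ : ℝ => |x / 2 * exp τ| • ((x / 2 * exp τ) ^ (v - 1) *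
      exp (-(x / 2 * exp τ) - x ^ 2 / 4 / (x / 2 * exp τ)))) = fun τ => (x / 2) ^ v * g τ := by
    funext τ
    have h1 : 0 < x / 2 * exp τ := by positivity
    simp only [hg]
    rw [abs_of_pos h1, smul_eq_mul, rpow_sub_one h1.ne', mul_rpow (by positivity) (by positivity),
      ← exp_mul, cosh_eq, mul_comm v τ,
      show -(x / 2 * exp τ) - x ^ 2 / 4 / (x / 2 * exp τ) = -x * ((exp τ + exp (-τ)) / 2) by
        rw [exp_neg]; field_simp; ring]
    field_simp
  have hint : Integrable g := by
    have h := integrableOn_macdonaldInt v (by positivity : 0 < x ^ 2 / 4)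
    rw [← himg, integrableOn_image_iff_integrableOn_abs_deriv_smul MeasurableSet.univ hder hinj,
      hpt, integrableOn_univ] at h
    exact (integrable_const_mul_iff (IsUnit.mk0 _ (by positivity : (x / 2) ^ v ≠ 0)) _).1 h
  have hneg : ∫ τ in Iic 0, g τ = ∫ τ in Ioi 0, g (-τ) := by
    rw [integral_comp_neg_Ioi, neg_zero]
  have hint' : IntegrableOn (fun τ => g (-τ)) (Ioi 0) := (hint.comp_neg).integrableOn
  rw [macdonaldInt, ← himg, integral_image_eq_integral_abs_deriv_smul MeasurableSet.univ hder hinj,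
    hpt, setIntegral_univ, integral_const_mul, ← intervalIntegral.integral_Iic_add_Ioi
      (b := 0) hint.integrableOn hint.integrableOn, hneg, ← integral_add hint' hint.integrableOn,
    besselK, mul_comm 2, mul_assoc]
  congr 1
  rw [← integral_const_mul]
  refine setIntegral_congr_fun measurableSet_Ioi fun τ _ => ?_
  simp only [hg, cosh_neg, cosh_eq (v * τ), mul_neg]
  ring

/-! ### Trigonometric integrals and the Gamma integral -/

/-- The sine transform of `(1 + u ^ 2) ^ (-a)`. -/
noncomputable def sinInt (a x : ℝ) : ℝ := ∫ u in Ioi (0 : ℝ), sin (x * u) * (1 + u ^ 2) ^ (-a)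

/-- The cosine transform of `(1 + u ^ 2) ^ (-a)`. -/
noncomputable def cosInt (a x : ℝ) : ℝ := ∫ u in Ioi (0 : ℝ), cos (x * u) * (1 + u ^ 2) ^ (-a)

theorem integrable_one_add_sq_rpow_neg {a : ℝ} (ha : 1 / 2 < a) :
    Integrable fun u : ℝ => (1 + u ^ 2) ^ (-a) := by
  have := integrable_rpow_neg_one_add_norm_sq (E := ℝ) (μ := volume) (r := 2 * a)
    (by simp; linarith)
  simpa [neg_mul, neg_div] using this

theorem integrable_mul_one_add_sq_rpow_neg {a : ℝ} (ha : 1 / 2 < a) {φ : ℝ → ℝ}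
    (hφm : Measurable φ) (hφ : ∀ u, |φ u| ≤ 1) :
    Integrable fun u : ℝ => φ u * (1 + u ^ 2) ^ (-a) := by
  refine (integrable_one_add_sq_rpow_neg ha).mono' (by fun_prop) (ae_of_all _ fun u => ?_)
  rw [norm_mul, Real.norm_of_nonneg (by positivity : 0 ≤ (1 + u ^ 2) ^ (-a))]
  exact mul_le_of_le_one_left (by positivity) (hφ u)

theorem integral_rpow_mul_exp_neg_one_add_sq {a : ℝ} (ha : 0 < a) (u : ℝ) :
    ∫ s in Ioi (0 : ℝ), s ^ (a - 1) * exp (-((1 + u ^ 2) * s)) = (1 + u ^ 2) ^ (-a) * Gamma a := by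
  rw [integral_rpow_mul_exp_neg_mul_Ioi ha (by positivity), one_div, inv_rpow (by positivity),
    rpow_neg (by positivity)]

theorem integrable_prod_gamma_kernel {a : ℝ} (ha : 1 / 2 < a) {φ : ℝ → ℝ} (hφm : Measurable φ)
    (hφ : ∀ u, |φ u| ≤ 1) :
    Integrable (fun p : ℝ × ℝ => φ p.1 * (p.2 ^ (a - 1) * exp (-((1 + p.1 ^ 2) * p.2))))
      ((volume.restrict (Ioi 0)).prod (volume.restrict (Ioi 0))) := by
  have hbase : Integrable (fun p : ℝ × ℝ => p.2 ^ (a - 1) * exp (-((1 + p.1 ^ 2) * p.2)))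
      ((volume.restrict (Ioi 0)).prod (volume.restrict (Ioi 0))) := by
    refine (integrable_prod_iff (by fun_prop)).2 ⟨ae_of_all _ fun u => ?_, ?_⟩
    -- The integral of a non-integrable function is `0` by convention, so an integral with nonzero
    -- value proves integrability.
    · refine not_imp_comm.1 integral_undef ?_
      dsimp only
      rw [integral_rpow_mul_exp_neg_one_add_sq (by linarith)]
      have := Gamma_pos_of_pos (by linarith : 0 < a)
      positivity
    · refine (((integrable_one_add_sq_rpow_neg ha).mul_const (Gamma a)).integrableOn).congr
        (ae_of_all _ fun u => ?_)
      dsimp only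
      rw [← integral_rpow_mul_exp_neg_one_add_sq (by linarith)]
      refine setIntegral_congr_fun measurableSet_Ioi fun s (hs : 0 < s) => ?_
      rw [Real.norm_of_nonneg (by positivity)]
  refine hbase.norm.mono' (by fun_prop) (ae_of_all _ fun p => ?_)
  rw [norm_mul]
  exact mul_le_of_le_one_left (norm_nonneg _) (hφ _)

theorem gamma_kernel_eq (φ : ℝ → ℝ) (a s : ℝ) :
    ∫ u in Ioi (0 : ℝ), φ u * (s ^ (a - 1) * exp (-((1 + u ^ 2) * s))) =
      s ^ (a - 1) * exp (-s) * ∫ u in Ioi (0 : ℝ), φ u * exp (-s * u ^ 2) := by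
  rw [← integral_const_mul]
  congr 1
  funext u
  rw [show -((1 + u ^ 2) * s) = -s + -s * u ^ 2 by ring, exp_add]
  ring

/-- This by-product of the first exchange of integrals justifies the second one, in `sinInt_eq`. -/
theorem integrableOn_gamma_mul_integral {a : ℝ} (ha : 1 / 2 < a) {φ : ℝ → ℝ} (hφm : Measurable φ)
    (hφ : ∀ u, |φ u| ≤ 1) :
    IntegrableOn (fun s => s ^ (a - 1) * exp (-s) * ∫ u in Ioi (0 : ℝ), φ u * exp (-s * u ^ 2))
      (Ioi 0) := by
  refine (integrable_prod_gamma_kernel ha hφm hφ).integral_prod_right.congr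
    (ae_of_all _ fun s => ?_)
  exact gamma_kernel_eq φ a s

theorem integral_mul_one_add_sq_rpow_neg {a : ℝ} (ha : 1 / 2 < a) {φ : ℝ → ℝ} (hφm : Measurable φ)
    (hφ : ∀ u, |φ u| ≤ 1) :
    ∫ u in Ioi (0 : ℝ), φ u * (1 + u ^ 2) ^ (-a) = (Gamma a)⁻¹ *
      ∫ s in Ioi (0 : ℝ), s ^ (a - 1) * exp (-s) * ∫ u in Ioi (0 : ℝ), φ u * exp (-s * u ^ 2) := by
  have hG := (Gamma_pos_of_pos (by linarith : 0 < a)).ne'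
  have h := integral_integral_swap (f := fun u s => φ u * (s ^ (a - 1) * exp (-((1 + u ^ 2) * s))))
    (integrable_prod_gamma_kernel ha hφm hφ)
  simp_rw [gamma_kernel_eq, integral_const_mul,
    integral_rpow_mul_exp_neg_one_add_sq (by linarith : 0 < a), ← mul_assoc, integral_mul_const] at h
  rw [eq_inv_mul_iff_mul_eq₀ hG, mul_comm, h]

/-! ### The cosine transform -/

theorem integral_Ioi_cos_mul_exp_neg_mul_sq (x : ℝ) {s : ℝ} (hs : 0 < s) :
    ∫ u in Ioi (0 : ℝ), cos (x * u) * exp (-s * u ^ 2) =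
      √(π / s) / 2 * exp (-(x ^ 2 / 4 / s)) := by
  have h1 := integral_comp_abs (f := fun u : ℝ => cos (x * u) * exp (-s * u ^ 2))
  have h2 : (fun u : ℝ => cos (x * |u|) * exp (-s * |u| ^ 2)) =
      fun u => cos (x * u) * exp (-s * u ^ 2) := by
    funext u
    rw [sq_abs]
    rcases abs_choice u with h | h <;> rw [h]
    rw [mul_neg, cos_neg]
  rw [h2] at h1
  have h3 := congrArg Complex.re (fourierIntegral_gaussian (b := s) (by simpa using hs) x)
  have hint : Integrable fun u : ℝ =>
      Complex.exp (Complex.I * x * u) * Complex.exp (-(s : ℂ) * u ^ 2) := by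
    refine (integrable_exp_neg_mul_sq hs).mono' (by fun_prop) (ae_of_all _ fun u => ?_)
    rw [norm_mul, Complex.norm_exp, Complex.norm_exp]
    simp [← Complex.ofReal_pow]
  have h4 : (∫ u : ℝ, Complex.exp (Complex.I * x * u) * Complex.exp (-(s : ℂ) * u ^ 2)).re =
      ∫ u : ℝ, cos (x * u) * exp (-s * u ^ 2) := by
    rw [← RCLike.re_eq_complex_re, ← integral_re hint]
    congr 1
    funext u
    rw [show Complex.I * (x : ℂ) * u = ((x * u : ℝ) : ℂ) * Complex.I by push_cast; ring,
      show -(s : ℂ) * (u : ℂ) ^ 2 = ((-s * u ^ 2 : ℝ) : ℂ) by push_cast; ring,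
      ← Complex.ofReal_exp, RCLike.re_eq_complex_re, Complex.re_mul_ofReal,
      Complex.exp_ofReal_mul_I_re]
  have h5 : ((π / s : ℂ) ^ (1 / 2 : ℂ) * Complex.exp (-(x : ℂ) ^ 2 / (4 * s))).re =
      √(π / s) * exp (-(x ^ 2 / 4 / s)) := by
    rw [show (π / s : ℂ) = ((π / s : ℝ) : ℂ) by push_cast; rfl,
      show (1 / 2 : ℂ) = ((1 / 2 : ℝ) : ℂ) by push_cast; rfl,
      ← Complex.ofReal_cpow (by positivity),
      show -(x : ℂ) ^ 2 / (4 * s) = ((-(x ^ 2 / 4 / s) : ℝ) : ℂ) by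
        push_cast; rw [div_div, neg_div], ← Complex.ofReal_exp, ← Complex.ofReal_mul,
      Complex.ofReal_re, sqrt_eq_rpow]
  rw [h4, h5] at h3
  linarith

theorem cosInt_eq {a : ℝ} (ha : 1 / 2 < a) (x : ℝ) :
    cosInt a x = √π / (2 * Gamma a) * macdonaldInt (a - 1 / 2) (x ^ 2 / 4) := by
  rw [cosInt, integral_mul_one_add_sq_rpow_neg ha (φ := fun u => cos (x * u)) (by fun_prop)
    fun u => abs_cos_le_one _, macdonaldInt, ← integral_const_mul, ← integral_const_mul]
  refine setIntegral_congr_fun measurableSet_Ioi fun s (hs : 0 < s) => ?_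
  rw [integral_Ioi_cos_mul_exp_neg_mul_sq x hs, sqrt_div pi_pos.le, sqrt_eq_rpow s,
    show a - 1 / 2 - 1 = (a - 1) - 1 / 2 by ring, rpow_sub hs (a - 1), sub_eq_add_neg (-s), exp_add]
  have : s ^ (1 / 2 : ℝ) ≠ 0 := (rpow_pos_of_pos hs _).ne'
  field_simp

/-! ### The sine transform -/

/-- Differentiation brings down a factor `u`, and `u exp (-s u ^ 2)` is an exact derivative.
Integration by parts returns the sine integral, with boundary term `1 / (2 s)`: Dawson's
differential equation. -/
theorem hasDerivAt_integral_sin_mul_exp_neg_mul_sq (x : ℝ) {s : ℝ} (hs : 0 < s) :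
    HasDerivAt (fun x => ∫ u in Ioi (0 : ℝ), sin (x * u) * exp (-s * u ^ 2))
      (1 / (2 * s) - x / (2 * s) * ∫ u in Ioi (0 : ℝ), sin (x * u) * exp (-s * u ^ 2)) x := by
  have hi1 : IntegrableOn (fun u : ℝ => exp (-s * u ^ 2)) (Ioi 0) :=
    (integrable_exp_neg_mul_sq hs).integrableOn
  have hi2 : IntegrableOn (fun u : ℝ => u * exp (-s * u ^ 2)) (Ioi 0) :=
    (integrable_mul_exp_neg_mul_sq hs).integrableOn
  have hsin : IntegrableOn (fun u : ℝ => sin (x * u) * exp (-s * u ^ 2)) (Ioi 0) := by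
    refine hi1.mono' (by fun_prop) (ae_of_all _ fun u => ?_)
    rw [norm_mul, Real.norm_eq_abs, Real.norm_eq_abs, abs_of_pos (exp_pos _)]
    exact mul_le_of_le_one_left (exp_pos _).le (abs_sin_le_one _)
  have key := (hasDerivAt_integral_of_dominated_loc_of_deriv_le (μ := volume.restrict (Ioi (0 : ℝ)))
    (F := fun x u => sin (x * u) * exp (-s * u ^ 2))
    (F' := fun x u => cos (x * u) * u * exp (-s * u ^ 2))
    (bound := fun u => u * exp (-s * u ^ 2)) (x₀ := x) (s := univ) univ_mem
    (Eventually.of_forall fun y => by fun_prop) hsin (by fun_prop) ?_ hi2 ?_)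
  · have h := integral_Ioi_of_hasDerivAt_of_tendsto' (a := 0) (m := 0)
      (f := fun u => -(cos (x * u) * exp (-s * u ^ 2)) / (2 * s))
      (f' := fun u => cos (x * u) * u * exp (-s * u ^ 2) +
        x / (2 * s) * (sin (x * u) * exp (-s * u ^ 2))) (fun u _ => ?_)
      (key.1.add (hsin.const_mul _)) ?_
    · rw [integral_add key.1 (hsin.const_mul _), integral_const_mul] at h
      refine key.2.congr_deriv ?_
      rw [mul_zero, cos_zero, zero_pow two_ne_zero, mul_zero, exp_zero, neg_div, mul_one] at h
      linarith
    · have h1 : HasDerivAt (fun u => cos (x * u)) (-sin (x * u) * x) u := by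
        simpa using ((hasDerivAt_id u).const_mul x).cos
      have h2 : HasDerivAt (fun u => exp (-s * u ^ 2)) (exp (-s * u ^ 2) * (-s * (2 * u))) u := by
        simpa using ((hasDerivAt_pow 2 u).const_mul (-s)).exp
      refine ((h1.mul h2).neg.div_const (2 * s)).congr_deriv ?_
      field_simp
      ring
    · have h1 : Tendsto (fun u : ℝ => exp (-s * u ^ 2)) atTop (𝓝 0) := by
        refine tendsto_exp_atBot.comp ?_
        exact (tendsto_pow_atTop (two_ne_zero)).const_mul_atTop_of_neg (neg_lt_zero.2 hs)
      have h2 : Tendsto (fun u : ℝ => cos (x * u) * exp (-s * u ^ 2)) atTop (𝓝 0) :=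
        squeeze_zero_norm (fun u => by
          rw [norm_mul, Real.norm_eq_abs, Real.norm_eq_abs, abs_of_pos (exp_pos _)]
          exact mul_le_of_le_one_left (exp_pos _).le (abs_cos_le_one _)) h1
      simpa using h2.neg.div_const (2 * s)
  · refine (ae_restrict_iff' measurableSet_Ioi).2 (ae_of_all _ fun u (hu : 0 < u) y _ => ?_)
    rw [norm_mul, norm_mul, Real.norm_eq_abs, Real.norm_eq_abs, Real.norm_eq_abs,
      abs_of_pos (exp_pos _), abs_of_pos hu, mul_assoc]
    exact mul_le_of_le_one_left (by positivity) (abs_cos_le_one _)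
  · refine ae_of_all _ fun u y _ => ?_
    simpa only [id, one_mul] using
      (((hasDerivAt_id y).mul_const u).sin).mul_const (exp (-s * u ^ 2))

/-- The equation is solved with the integrating factor `exp (x ^ 2 / (4 s))` and the value `0` at `x
= 0`; then the integration variable is scaled to `(0, 1)`. -/
theorem integral_Ioi_sin_mul_exp_neg_mul_sq (x : ℝ) {s : ℝ} (hs : 0 < s) :
    ∫ u in Ioi (0 : ℝ), sin (x * u) * exp (-s * u ^ 2) =
      x / (2 * s) * ∫ w in Ioo (0 : ℝ) 1, exp (-(x ^ 2 / 4 * (1 - w ^ 2) / s)) := by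
  set D : ℝ → ℝ := fun x => ∫ u in Ioi (0 : ℝ), sin (x * u) * exp (-s * u ^ 2) with hD
  have hder : ∀ y : ℝ, HasDerivAt (fun y => D y * exp (y ^ 2 / 4 / s))
      (exp (y ^ 2 / 4 / s) / (2 * s)) y := by
    intro y
    have h2 : HasDerivAt (fun y => exp (y ^ 2 / 4 / s))
        (exp (y ^ 2 / 4 / s) * (2 * y / 4 / s)) y := by
      simpa using (((hasDerivAt_pow 2 y).div_const 4).div_const s).exp
    refine ((hasDerivAt_integral_sin_mul_exp_neg_mul_sq y hs).mul h2).congr_deriv ?_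
    field_simp
    ring
  have h1 := intervalIntegral.integral_eq_sub_of_hasDerivAt (a := 0) (b := x)
    (fun y _ => hder y) (Continuous.intervalIntegrable (by fun_prop) _ _)
  have hD0 : D 0 = 0 := by simp [hD]
  rw [hD0, zero_mul, sub_zero] at h1
  have h2 := intervalIntegral.smul_integral_comp_mul_left (a := 0) (b := 1)
    (fun y => exp (y ^ 2 / 4 / s) / (2 * s)) x
  rw [mul_zero, mul_one, h1, smul_eq_mul, intervalIntegral.integral_of_le zero_le_one,
    integral_Ioc_eq_integral_Ioo] at h2
  have h3 : D x = x * (exp (-(x ^ 2 / 4 / s)) *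
      ∫ w in Ioo (0 : ℝ) 1, exp ((x * w) ^ 2 / 4 / s) / (2 * s)) := by
    rw [mul_left_comm, h2, mul_left_comm, ← exp_add]
    simp
  change D x = _
  rw [h3, ← integral_const_mul, ← integral_const_mul, ← integral_const_mul]
  congr 1
  funext w
  rw [show -(x ^ 2 / 4 * (1 - w ^ 2) / s) = -(x ^ 2 / 4 / s) + (x * w) ^ 2 / 4 / s by ring, exp_add]
  ring

theorem sinInt_eq {a : ℝ} (ha : 1 / 2 < a) {x : ℝ} (hx : 0 < x) :
    sinInt a x = x / (2 * Gamma a) *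
      ∫ w in Ioo (0 : ℝ) 1, macdonaldInt (a - 1) (x ^ 2 / 4 * (1 - w ^ 2)) := by
  have hi := integrableOn_gamma_mul_integral ha (φ := fun u => sin (x * u)) (by fun_prop)
    fun u => abs_sin_le_one _
  set G : ℝ → ℝ → ℝ := fun s w =>
    s ^ (a - 1 - 1) * exp (-s - x ^ 2 / 4 * (1 - w ^ 2) / s) with hG
  have hinner : ∀ s ∈ Ioi (0 : ℝ), s ^ (a - 1) * exp (-s) *
      ∫ u in Ioi (0 : ℝ), sin (x * u) * exp (-s * u ^ 2) =
        x / 2 * ∫ w in Ioo (0 : ℝ) 1, G s w := by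
    intro s (hs : 0 < s)
    rw [integral_Ioi_sin_mul_exp_neg_mul_sq x hs, ← integral_const_mul, ← integral_const_mul,
      ← integral_const_mul]
    congr 1
    funext w
    simp only [hG]
    rw [rpow_sub_one hs.ne' (a - 1), sub_eq_add_neg (-s), exp_add]
    field_simp
  have hi2 : IntegrableOn (fun s => ∫ w in Ioo (0 : ℝ) 1, G s w) (Ioi 0) := by
    have h := hi.congr_fun hinner measurableSet_Ioi
    exact (integrable_const_mul_iff (IsUnit.mk0 _ (by positivity : x / 2 ≠ 0)) _).1 h
  -- The kernel is nonnegative on the domain, so integrability of the iterated integral `hi2`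
  -- controls the norm on the product.
  have hGi : Integrable (Function.uncurry G)
      ((volume.restrict (Ioi 0)).prod (volume.restrict (Ioo 0 1))) := by
    refine (integrable_prod_iff (by simp only [hG, Function.uncurry_def]; fun_prop)).2
      ⟨?_, hi2.congr ?_⟩
    · refine ae_of_all _ fun s => ?_
      have : IntegrableOn (G s) (Icc 0 1) := by
        refine ContinuousOn.integrableOn_Icc (Continuous.continuousOn ?_)
        simp only [hG]
        fun_prop
      exact this.mono_set Ioo_subset_Icc_self
    · refine (ae_restrict_iff' measurableSet_Ioi).2 (ae_of_all _ fun s (hs : 0 < s) => ?_)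
      refine integral_congr_ae (ae_of_all _ fun w => ?_)
      simp only [hG, Function.uncurry_apply_pair]
      rw [Real.norm_of_nonneg (by positivity)]
  rw [sinInt, integral_mul_one_add_sq_rpow_neg ha (φ := fun u => sin (x * u)) (by fun_prop)
    fun u => abs_sin_le_one _, setIntegral_congr_fun measurableSet_Ioi hinner, integral_const_mul,
    integral_integral_swap hGi, ← mul_assoc]
  congr 1
  field_simp

/-! ### Beta integrals and the sine transform as a power series -/

theorem integral_rpow_mul_one_sub_rpow {a b : ℝ} (ha : 0 < a) (hb : 0 < b) :
    ∫ t in Ioo (0 : ℝ) 1, t ^ (a - 1) * (1 - t) ^ (b - 1) = Gamma a * Gamma b / Gamma (a + b) := by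
  rw [← ProbabilityTheory.beta, beta_eq_betaIntegralReal a b ha hb, Complex.betaIntegral,
    intervalIntegral.integral_of_le zero_le_one, integral_Ioc_eq_integral_Ioo,
    ← Complex.ofReal_re (∫ t in Ioo (0 : ℝ) 1, t ^ (a - 1) * (1 - t) ^ (b - 1)),
    ← integral_complex_ofReal]
  congr 1
  refine setIntegral_congr_fun measurableSet_Ioo fun t ht => ?_
  have h1 : 0 ≤ t := ht.1.le
  have h2 : 0 ≤ 1 - t := by linarith [ht.2]
  push_cast
  rw [Complex.ofReal_cpow h1, Complex.ofReal_cpow h2]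
  push_cast
  rfl

/-- With `t = w ^ 2` this is half the Beta integral with parameters `1 / 2` and `p + 1`. -/
theorem integral_one_sub_sq_rpow {p : ℝ} (hp : -1 < p) :
    ∫ w in Ioo (0 : ℝ) 1, (1 - w ^ 2) ^ p = √π * Gamma (p + 1) / (2 * Gamma (p + 3 / 2)) := by
  have h1 := integral_rpow_mul_one_sub_rpow (a := 1 / 2) (b := p + 1) (by norm_num) (by linarith)
  have himg : (fun w : ℝ => w ^ 2) '' Ioo 0 1 = Ioo 0 1 := by
    ext t
    constructor
    · rintro ⟨w, hw, rfl⟩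
      exact ⟨pow_pos hw.1 2, pow_lt_one₀ hw.1.le hw.2 two_ne_zero⟩
    · intro ht
      exact ⟨√t, ⟨sqrt_pos.2 ht.1, (sqrt_lt' one_pos).2 (by simpa using ht.2)⟩, sq_sqrt ht.1.le⟩
  have h2 := integral_image_eq_integral_abs_deriv_smul (f := fun w : ℝ => w ^ 2)
    (f' := fun w => 2 * w) (s := Ioo 0 1) measurableSet_Ioo
    (fun w _ => by simpa using (hasDerivAt_pow 2 w).hasDerivWithinAt)
    (fun x hx y hy h => by
      simpa [sq_eq_sq₀ hx.1.le hy.1.le] using h)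
    (fun t => t ^ ((1 : ℝ) / 2 - 1) * (1 - t) ^ (p + 1 - 1))
  rw [himg, h1, Gamma_one_half_eq, show 1 / 2 + (p + 1) = p + 3 / 2 by ring] at h2
  have h3 : ∀ w ∈ Ioo (0 : ℝ) 1,
      |2 * w| • ((w ^ 2) ^ ((1 : ℝ) / 2 - 1) * (1 - w ^ 2) ^ (p + 1 - 1)) =
        2 * (1 - w ^ 2) ^ p := by
    intro w hw
    have hw0 := hw.1
    rw [abs_of_pos (by positivity), smul_eq_mul, add_sub_cancel_right, ← rpow_natCast w 2,
      ← rpow_mul hw0.le]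
    norm_num
    rw [rpow_neg_one]
    field_simp
  rw [setIntegral_congr_fun measurableSet_Ioo h3, integral_const_mul] at h2
  rw [mul_comm 2, ← div_div, h2]
  ring

theorem integrableOn_one_sub_sq_rpow {p : ℝ} (hp : -1 < p) :
    IntegrableOn (fun w : ℝ => (1 - w ^ 2) ^ p) (Ioo 0 1) := by
  refine not_imp_comm.1 integral_undef ?_
  rw [integral_one_sub_sq_rpow hp]
  have h1 := Gamma_pos_of_pos (by linarith : 0 < p + 1)
  have h2 := Gamma_pos_of_pos (by linarith : 0 < p + 3 / 2)
  positivity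

theorem integrableOn_rpow_mul_besselClifford {r : ℝ} (hr : -1 < r) (q y : ℝ) :
    IntegrableOn (fun w : ℝ => (1 - w ^ 2) ^ r * besselClifford q (y * (1 - w ^ 2))) (Ioo 0 1) := by
  have hc : Continuous fun w : ℝ => besselClifford q (y * (1 - w ^ 2)) :=
    (continuous_besselClifford q).comp (by fun_prop)
  obtain ⟨C, hC⟩ := isCompact_Icc.exists_bound_of_continuousOn (s := Icc (0 : ℝ) 1) hc.continuousOn
  refine (integrableOn_one_sub_sq_rpow hr).mul_bdd (c := C) hc.aestronglyMeasurable ?_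
  exact (ae_restrict_iff' measurableSet_Ioo).2
    (ae_of_all _ fun w hw => hC w (Ioo_subset_Icc_self hw))

/-- Termwise integration is allowed because `(1 - w ^ 2) ^ (k + r) ≤ (1 - w ^ 2) ^ r`, so the norms
are dominated by the absolutely convergent series at `y`. -/
theorem integral_rpow_mul_besselClifford {r : ℝ} (hr : -1 < r) (q y : ℝ) :
    ∫ w in Ioo (0 : ℝ) 1, (1 - w ^ 2) ^ r * besselClifford q (y * (1 - w ^ 2)) =
      ∑' k : ℕ, y ^ k / ((Nat.factorial k : ℝ) * Gamma (k + q)) *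
        (√π * Gamma (k + r + 1) / (2 * Gamma (k + r + 3 / 2))) := by
  have hk : ∀ k : ℕ, -1 < (k : ℝ) + r := fun k => by
    have : (0 : ℝ) ≤ k := k.cast_nonneg
    linarith
  set F : ℕ → ℝ → ℝ := fun k w =>
    y ^ k / ((Nat.factorial k : ℝ) * Gamma (k + q)) * (1 - w ^ 2) ^ (k + r) with hF
  have hpos : ∀ w ∈ Ioo (0 : ℝ) 1, 0 < 1 - w ^ 2 := fun w hw => by
    have := pow_lt_one₀ hw.1.le hw.2 two_ne_zero
    linarith
  have hFi : ∀ k, IntegrableOn (F k) (Ioo 0 1) := fun k =>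
    (integrableOn_one_sub_sq_rpow (hk k)).const_mul _
  have hsum : Summable fun k => ∫ w in Ioo (0 : ℝ) 1, ‖F k w‖ := by
    refine Summable.of_nonneg_of_le (fun k => integral_nonneg fun w => norm_nonneg _) (fun k => ?_)
      ((summable_besselClifford q y).abs.mul_right (∫ w in Ioo (0 : ℝ) 1, (1 - w ^ 2) ^ r))
    rw [← integral_const_mul]
    refine setIntegral_mono_on (hFi k).norm ((integrableOn_one_sub_sq_rpow hr).const_mul _)
      measurableSet_Ioo fun w hw => ?_
    have h0 := hpos w hw
    rw [hF, norm_mul, Real.norm_eq_abs, Real.norm_of_nonneg (by positivity)]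
    gcongr ?_ * ?_
    exact rpow_le_rpow_of_exponent_ge h0 (by nlinarith) (by simp)
  have h := (hasSum_integral_of_summable_integral_norm hFi hsum).tsum_eq
  have hpt : ∀ w ∈ Ioo (0 : ℝ) 1,
      (1 - w ^ 2) ^ r * besselClifford q (y * (1 - w ^ 2)) = ∑' k, F k w := by
    intro w hw
    rw [besselClifford, ← tsum_mul_left]
    refine tsum_congr fun k => ?_
    simp only [hF]
    rw [rpow_add (hpos w hw), rpow_natCast, mul_pow]
    ring
  rw [setIntegral_congr_fun measurableSet_Ioo hpt, ← h]
  refine tsum_congr fun k => ?_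
  simp only [hF]
  rw [integral_const_mul, integral_one_sub_sq_rpow (hk k)]

/-- In the series with exponent `0` the Beta integral cancels `k!` and leaves the Struve
coefficients; in the one with exponent `v` it cancels `Γ(k + v + 1)` and leaves the Bessel
coefficients. The relation `sin (π v) = -cos (π ν / 2)` reverses the order of the difference. -/
theorem sinInt_eq_besselI_sub_struveL {ν : ℝ} (hν : 0 < ν)
    (hodd : ¬∃ n : ℕ, 1 ≤ n ∧ ν = 2 * n - 1) {x : ℝ} (hx : 0 < x) :
    sinInt ((ν + 1) / 2) x = √π * π / (2 * Gamma ((ν + 1) / 2) * cos (π * ν / 2)) *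
      (x / 2) ^ (ν / 2) * (besselI (ν / 2) x - struveL (-(ν / 2)) x) := by
  set v := (ν - 1) / 2 with hv
  have hvint : ∀ n : ℤ, v ≠ n := by
    intro n hn
    have h1 : ν = 2 * n + 1 := by linarith
    have h2 : 0 ≤ n := by
      by_contra! h
      have : (n : ℝ) ≤ -1 := by exact_mod_cast Int.le_sub_one_of_lt h
      linarith
    lift n to ℕ using h2
    refine hodd ⟨n + 1, by omega, ?_⟩
    push_cast at h1 ⊢
    linarith
  have hv1 : -1 < v := by linarith
  have hX : 0 < x / 2 := half_pos hx
  set y := x ^ 2 / 4 with hy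
  have hy0 : 0 < y := by positivity
  have hyk : ∀ k : ℕ, (x / 2) ^ (2 * (k : ℝ)) = y ^ k := fun k => by
    rw [rpow_mul hX.le, show (2 : ℝ) = ((2 : ℕ) : ℝ) by norm_num, rpow_natCast, rpow_natCast, hy]
    norm_num [div_pow]
  have hyv : y ^ v = (x / 2) ^ (ν - 1) := by
    rw [show y = (x / 2) ^ (2 : ℝ) by rw [rpow_two, hy]; ring, ← rpow_mul hX.le]
    congr 1
    rw [hv]; ring
  have hpi : 0 < √π := sqrt_pos.2 pi_pos
  have hL : struveL (-(ν / 2)) x = (x / 2) ^ (1 - ν / 2) * (2 / √π) *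
      ∫ w in Ioo (0 : ℝ) 1, (1 - w ^ 2) ^ (0 : ℝ) * besselClifford (1 - v) (y * (1 - w ^ 2)) := by
    rw [integral_rpow_mul_besselClifford (by norm_num), struveL, ← tsum_mul_left]
    refine tsum_congr fun k => ?_
    rw [show 2 * (k : ℝ) + -(ν / 2) + 1 = 2 * k + (1 - ν / 2) by ring, rpow_add hX, hyk,
      show (k : ℝ) + -(ν / 2) + 3 / 2 = k + (1 - v) by rw [hv]; ring, add_zero,
      Gamma_nat_eq_factorial]
    have := Nat.factorial_pos k
    field_simp
  have hI : besselI (ν / 2) x = (x / 2) ^ (ν / 2) * (2 / √π) *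
      ∫ w in Ioo (0 : ℝ) 1, (1 - w ^ 2) ^ v * besselClifford (1 + v) (y * (1 - w ^ 2)) := by
    rw [integral_rpow_mul_besselClifford hv1, besselI, ← tsum_mul_left]
    refine tsum_congr fun k => ?_
    rw [rpow_add hX, hyk, show (k : ℝ) + v + 3 / 2 = k + ν / 2 + 1 by rw [hv]; ring,
      show (k : ℝ) + (1 + v) = k + v + 1 by ring]
    have : 0 < Gamma (k + v + 1) := Gamma_pos_of_pos (by
      have : (0 : ℝ) ≤ k := k.cast_nonneg
      linarith)
    field_simp
  have hmain : ∫ w in Ioo (0 : ℝ) 1, macdonaldInt v (y * (1 - w ^ 2)) = π / sin (π * v) *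
      ((∫ w in Ioo (0 : ℝ) 1, (1 - w ^ 2) ^ (0 : ℝ) * besselClifford (1 - v) (y * (1 - w ^ 2))) -
        y ^ v * ∫ w in Ioo (0 : ℝ) 1,
          (1 - w ^ 2) ^ v * besselClifford (1 + v) (y * (1 - w ^ 2))) := by
    rw [← integral_const_mul (y ^ v), ← integral_sub
      (integrableOn_rpow_mul_besselClifford (by norm_num) _ _)
      ((integrableOn_rpow_mul_besselClifford hv1 _ _).const_mul _), ← integral_const_mul]
    refine setIntegral_congr_fun measurableSet_Ioo fun w hw => ?_
    have h0 : 0 < 1 - w ^ 2 := by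
      have := pow_lt_one₀ hw.1.le hw.2 two_ne_zero
      linarith
    rw [macdonaldInt_eq_series hvint (mul_pos hy0 h0), macdonaldSeries, rpow_zero, one_mul,
      mul_rpow hy0.le h0.le, mul_assoc (y ^ v)]
  have hsin : sin (π * v) = -cos (π * ν / 2) := by
    rw [hv, ← sin_sub_pi_div_two]
    congr 1
    ring
  rw [sinInt_eq (by linarith) hx, show (ν + 1) / 2 - 1 = v by rw [hv]; ring, hmain, hL, hI, hsin,
    hyv, show ν - 1 = ν / 2 + ν / 2 - 1 by ring, rpow_sub_one hX.ne', rpow_add hX, rpow_sub hX,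
    rpow_one]
  have := (rpow_pos_of_pos hX (ν / 2)).ne'
  generalize (∫ w in Ioo (0 : ℝ) 1,
    (1 - w ^ 2) ^ (0 : ℝ) * besselClifford (1 - v) (y * (1 - w ^ 2))) = S
  generalize (∫ w in Ioo (0 : ℝ) 1,
    (1 - w ^ 2) ^ v * besselClifford (1 + v) (y * (1 - w ^ 2))) = T
  rw [div_neg]
  field_simp
  ring

/-! ### The exponential integral -/

/-- The exponential integral `∫_x^∞ exp (-s) / s ds`. -/
noncomputable def expIntegralE1 (x : ℝ) : ℝ := ∫ s in Ioi x, exp (-s) / s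

theorem integrableOn_exp_neg_div {x : ℝ} (hx : 0 < x) :
    IntegrableOn (fun s => exp (-s) / s) (Ioi x) := by
  refine ((integrableOn_exp_neg_Ioi x).const_mul x⁻¹).mono'
    (Measurable.aestronglyMeasurable (by fun_prop)) ?_
  refine (ae_restrict_iff' measurableSet_Ioi).2 (ae_of_all _ fun s (hs : x < s) => ?_)
  have hs0 : 0 < s := hx.trans hs
  rw [Real.norm_of_nonneg (by positivity), div_eq_inv_mul]
  gcongr

theorem expIntegralE1_nonneg {x : ℝ} (hx : 0 < x) : 0 ≤ expIntegralE1 x :=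
  setIntegral_nonneg measurableSet_Ioi fun s (hs : x < s) => by
    have hs0 : 0 < s := hx.trans hs
    positivity

theorem hasDerivAt_expIntegralE1 {x : ℝ} (hx : 0 < x) :
    HasDerivAt expIntegralE1 (-(exp (-x) / x)) x := by
  have hc : ContinuousOn (fun s : ℝ => exp (-s) / s) (Ioi 0) :=
    ContinuousOn.div (by fun_prop) (by fun_prop) fun s hs => ne_of_gt hs
  have hii : ∀ y, 0 < y → IntervalIntegrable (fun s : ℝ => exp (-s) / s) volume x y := by
    intro y hy
    refine (hc.mono fun s hs => ?_).intervalIntegrable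
    exact (lt_min hx hy).trans_le hs.1
  have heq : ∀ y, 0 < y →
      expIntegralE1 y = expIntegralE1 x - ∫ s in x..y, exp (-s) / s := by
    intro y hy
    have := intervalIntegral.integral_interval_add_Ioi (f := fun s : ℝ => exp (-s) / s)
      (a := x) (b := y) (integrableOn_exp_neg_div hx) (integrableOn_exp_neg_div hy)
    simp only [expIntegralE1]
    linarith
  have hd := (intervalIntegral.integral_hasDerivAt_right (hii x hx)
    ((hc.stronglyMeasurableAtFilter isOpen_Ioi) x hx)
    (hc.continuousAt (Ioi_mem_nhds hx))).const_sub (expIntegralE1 x)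
  refine hd.congr_of_eventuallyEq ?_
  filter_upwards [Ioi_mem_nhds hx] with y hy using heq y hy

theorem exp_mul_expIntegralE1_le_one {x : ℝ} (hx : 1 ≤ x) : exp x * expIntegralE1 x ≤ 1 := by
  have hx0 : 0 < x := by linarith
  have h1 : expIntegralE1 x ≤ ∫ s in Ioi x, exp (-s) := by
    refine setIntegral_mono_on (integrableOn_exp_neg_div hx0)
      (integrableOn_exp_neg_Ioi x) measurableSet_Ioi
      fun s (hs : x < s) => ?_
    exact div_le_self (exp_pos _).le (by linarith)
  rw [integral_exp_neg_Ioi] at h1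
  calc exp x * expIntegralE1 x ≤ exp x * exp (-x) := by gcongr
    _ = 1 := by rw [← exp_add, add_neg_cancel, exp_zero]

/-- For `s > x`, `x ≤ x ^ (1/2) s ^ (1/2)`, which bounds the product by `x ^ (1/2) Γ(1/2)`. -/
theorem tendsto_mul_expIntegralE1_zero :
    Tendsto (fun x => x * expIntegralE1 x) (𝓝[>] 0) (𝓝 0) := by
  have hb : ∀ x : ℝ, 0 < x → x * expIntegralE1 x ≤ x ^ (1 / 2 : ℝ) * Gamma (1 / 2) := by
    intro x hx
    have hint := GammaIntegral_convergent (s := 1 / 2) (by norm_num)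
    have h1 : x * expIntegralE1 x ≤
        ∫ s in Ioi x, x ^ (1 / 2 : ℝ) * (exp (-s) * s ^ ((1 : ℝ) / 2 - 1)) := by
      rw [expIntegralE1, ← integral_const_mul]
      refine setIntegral_mono_on ((integrableOn_exp_neg_div hx).const_mul _)
        ((hint.mono_set (Ioi_subset_Ioi hx.le)).const_mul _) measurableSet_Ioi
        fun s (hs : x < s) => ?_
      have hs0 : 0 < s := hx.trans hs
      have h2 : x ^ (1 / 2 : ℝ) ≤ s ^ (1 / 2 : ℝ) := by gcongr
      have h3 : x = x ^ (1 / 2 : ℝ) * x ^ (1 / 2 : ℝ) := by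
        rw [← rpow_add hx]; norm_num
      calc x * (exp (-s) / s) = x ^ (1 / 2 : ℝ) * x ^ (1 / 2 : ℝ) * (exp (-s) / s) := by rw [← h3]
        _ ≤ x ^ (1 / 2 : ℝ) * s ^ (1 / 2 : ℝ) * (exp (-s) / s) := by gcongr
        _ = x ^ (1 / 2 : ℝ) * (exp (-s) * s ^ ((1 : ℝ) / 2 - 1)) := by
          rw [rpow_sub_one hs0.ne']; ring
    refine h1.trans ?_
    rw [integral_const_mul, Gamma_eq_integral (by norm_num)]
    refine mul_le_mul_of_nonneg_left ?_ (by positivity)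
    refine setIntegral_mono_set hint ?_ (Ioi_subset_Ioi hx.le).eventuallyLE
    refine (ae_restrict_iff' measurableSet_Ioi).2 (ae_of_all _ fun s (hs : 0 < s) => ?_)
    simp only [Pi.zero_apply]
    positivity
  have hlim : Tendsto (fun x : ℝ => x ^ (1 / 2 : ℝ) * Gamma (1 / 2)) (𝓝[>] 0) (𝓝 0) := by
    have h : ContinuousAt (fun x : ℝ => x ^ (1 / 2 : ℝ) * Gamma (1 / 2)) 0 :=
      (continuousAt_rpow_const _ _ (Or.inr (by norm_num))).mul continuousAt_const
    simpa [ContinuousAt] using h.mono_left (nhdsWithin_le_nhds (s := Ioi 0))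
  refine squeeze_zero' ?_ ?_ hlim
  · filter_upwards [self_mem_nhdsWithin] with x (hx : 0 < x)
    exact mul_nonneg hx.le (expIntegralE1_nonneg hx)
  · filter_upwards [self_mem_nhdsWithin] with x hx using hb x hx

/-- The hyperbolic sine integral `∫_0^x sinh s / s ds`. -/
noncomputable def sinhIntegral (x : ℝ) : ℝ := ∫ s in (0 : ℝ)..x, dslope sinh 0 s

/-- `dslope` fills the removable singularity of `sinh s / s` at `0`. -/
theorem continuous_dslope_sinh : Continuous (dslope sinh 0) := by
  rw [← continuousOn_univ, continuousOn_dslope univ_mem]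
  exact ⟨continuous_sinh.continuousOn, differentiable_sinh.differentiableAt⟩

theorem dslope_sinh_of_ne {x : ℝ} (hx : x ≠ 0) : dslope sinh 0 x = sinh x / x := by
  rw [dslope_of_ne _ hx, slope_def_field]
  simp

theorem hasDerivAt_sinhIntegral (x : ℝ) : HasDerivAt sinhIntegral (dslope sinh 0 x) x :=
  continuous_dslope_sinh.integral_hasStrictDerivAt 0 x |>.hasDerivAt

theorem Ei_neg {x : ℝ} (hx : 0 < x) : Ei (-x) = -expIntegralE1 x := by
  refine Tendsto.limUnder_eq ?_
  have hval : ∫ t in Iic (-x), exp t / t = -expIntegralE1 x := by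
    rw [← integral_comp_neg_Ioi x (fun t => exp t / t), expIntegralE1, ← integral_neg]
    simp only [div_neg]
  refine tendsto_const_nhds.congr' ?_
  filter_upwards [Ioo_mem_nhdsGT hx] with ε hε
  rw [← hval]
  congr 2
  ext t
  simp only [mem_Iic, Set.mem_sdiff, mem_Ioo, not_and, not_lt]
  exact ⟨fun h => ⟨h, fun h' => by linarith [hε.2]⟩, fun h => h.1⟩

/-- On `(-x, x)` the contributions of `t` and `-t` combine to `2 sinh t / t`, so the singularity
cancels and the principal value exists. -/
theorem Ei_of_pos {x : ℝ} (hx : 0 < x) : Ei x = -expIntegralE1 x + 2 * sinhIntegral x := by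
  refine Tendsto.limUnder_eq ?_
  have hval : ∫ t in Iic (-x), exp t / t = -expIntegralE1 x := by
    rw [← integral_comp_neg_Ioi x (fun t => exp t / t), expIntegralE1, ← integral_neg]
    simp only [div_neg]
  have hi0 : IntegrableOn (fun t => exp t / t) (Iic (-x)) := by
    have h := (integrableOn_exp_neg_div hx).neg
    rw [← integrableOn_Ici_iff_integrableOn_Ioi, ← neg_neg x] at h
    refine h.comp_neg_Iic.congr_fun (fun t _ => ?_) measurableSet_Iic
    simp [div_neg]
  have hlim : Tendsto (fun ε => -expIntegralE1 x + 2 * (sinhIntegral x - sinhIntegral ε)) (𝓝[>] 0)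
      (𝓝 (-expIntegralE1 x + 2 * sinhIntegral x)) := by
    have h : ContinuousAt (fun ε => -expIntegralE1 x + 2 * (sinhIntegral x - sinhIntegral ε)) 0 :=
      continuousAt_const.add (continuousAt_const.mul
        (continuousAt_const.sub (hasDerivAt_sinhIntegral 0).continuousAt))
    have h0 : sinhIntegral 0 = 0 := by simp [sinhIntegral]
    simpa [ContinuousAt, h0] using h.mono_left (nhdsWithin_le_nhds (s := Ioi 0))
  refine hlim.congr' ?_
  filter_upwards [Ioo_mem_nhdsGT hx] with ε hε
  obtain ⟨hε0, hεx⟩ := hε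
  have hset : Iic x \ Ioo (-ε) ε = Iic (-x) ∪ (Ioc (-x) (-ε) ∪ Icc ε x) := by
    ext t
    simp only [mem_Iic, Set.mem_sdiff, mem_Ioo, not_and, not_lt, mem_union, mem_Ioc, mem_Icc]
    constructor
    · rintro ⟨h1, h2⟩
      rcases le_or_gt t (-x) with h | h
      · exact Or.inl h
      · rcases le_or_gt t (-ε) with h' | h'
        · exact Or.inr (Or.inl ⟨h, h'⟩)
        · exact Or.inr (Or.inr ⟨h2 h', h1⟩)
    · rintro (h | ⟨h1, h2⟩ | ⟨h1, h2⟩)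
      · exact ⟨by linarith, fun h' => by linarith⟩
      · exact ⟨by linarith, fun h' => by linarith⟩
      · exact ⟨h2, fun _ => h1⟩
  have hi1 : IntervalIntegrable (fun t => exp t / t) volume (-x) (-ε) := by
    refine (ContinuousOn.div (by fun_prop) (by fun_prop) fun t ht => ?_).intervalIntegrable
    rw [uIcc_of_le (by linarith)] at ht
    exact (by linarith [ht.2] : t < 0).ne
  have hi2 : IntervalIntegrable (fun t => exp t / t) volume ε x := by
    refine (ContinuousOn.div (by fun_prop) (by fun_prop) fun t ht => ?_).intervalIntegrable
    rw [uIcc_of_le (by linarith)] at ht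
    exact (by linarith [ht.1] : 0 < t).ne'
  have hi3 : IntervalIntegrable (fun t => exp (-t) / (-t)) volume ε x := by
    refine (ContinuousOn.div (by fun_prop) (by fun_prop) fun t ht => ?_).intervalIntegrable
    rw [uIcc_of_le (by linarith)] at ht
    exact (by linarith [ht.1] : -t < 0).ne
  have hi1' := (intervalIntegrable_iff_integrableOn_Ioc_of_le (by linarith)).1 hi1
  have hi2' := (intervalIntegrable_iff_integrableOn_Icc_of_le hεx.le).1 hi2
  rw [hset, setIntegral_union _ (measurableSet_Ioc.union measurableSet_Icc) hi0
    (hi1'.union hi2'), setIntegral_union _ measurableSet_Icc hi1' hi2', hval,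
    integral_Icc_eq_integral_Ioc, ← intervalIntegral.integral_of_le (by linarith : -x ≤ -ε),
    ← intervalIntegral.integral_of_le hεx.le, ← intervalIntegral.integral_comp_neg,
    ← intervalIntegral.integral_add hi3 hi2]
  · congr 1
    rw [sinhIntegral, sinhIntegral, intervalIntegral.integral_interval_sub_left
      (continuous_dslope_sinh.intervalIntegrable _ _)
      (continuous_dslope_sinh.intervalIntegrable _ _), ← intervalIntegral.integral_const_mul]
    refine intervalIntegral.integral_congr fun t ht => ?_
    rw [uIcc_of_le (by linarith)] at ht
    have ht0 : t ≠ 0 := (by linarith [ht.1] : 0 < t).ne'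
    rw [dslope_sinh_of_ne ht0, sinh_eq]
    field_simp
    ring
  · refine Set.disjoint_left.2 fun t h1 h2 => ?_
    linarith [h1.2, h2.1]
  · refine Set.disjoint_left.2 fun t h1 h2 => ?_
    rcases h2 with h2 | h2
    · exact absurd h2.1 (not_lt.2 h1)
    · have : t ≤ -x := h1
      linarith [h2.1]

/-- The function `exp (-x) Ei x`. -/
noncomputable def expNegMulEi (x : ℝ) : ℝ := exp (-x) * Ei x

/-- The function `exp x Ei (-x)`. -/
noncomputable def expMulEiNeg (x : ℝ) : ℝ := exp x * Ei (-x)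

theorem hasDerivAt_expNegMulEi {x : ℝ} (hx : 0 < x) :
    HasDerivAt expNegMulEi (-expNegMulEi x + 1 / x) x := by
  have h1 : HasDerivAt Ei (exp x / x) x := by
    refine (((hasDerivAt_expIntegralE1 hx).neg.add
      ((hasDerivAt_sinhIntegral x).const_mul 2)).congr_of_eventuallyEq ?_).congr_deriv ?_
    · filter_upwards [Ioi_mem_nhds hx] with y hy using Ei_of_pos hy
    · rw [dslope_sinh_of_ne hx.ne', sinh_eq]
      ring
  refine ((hasDerivAt_neg x).exp.mul h1).congr_deriv ?_
  rw [expNegMulEi, exp_neg]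
  field_simp

theorem hasDerivAt_expMulEiNeg {x : ℝ} (hx : 0 < x) :
    HasDerivAt expMulEiNeg (expMulEiNeg x + 1 / x) x := by
  have h1 : HasDerivAt (fun y => Ei (-y)) (exp (-x) / x) x := by
    refine ((hasDerivAt_expIntegralE1 hx).neg.congr_of_eventuallyEq ?_).congr_deriv (neg_neg _)
    filter_upwards [Ioi_mem_nhds hx] with y hy using Ei_neg hy
  refine ((hasDerivAt_exp x).mul h1).congr_deriv ?_
  rw [expMulEiNeg, exp_neg]
  field_simp

theorem tendsto_mul_expMulEiNeg_zero : Tendsto (fun x => x * expMulEiNeg x) (𝓝[>] 0) (𝓝 0) := by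
  have h1 : Tendsto exp (𝓝[>] 0) (𝓝 (exp 0)) :=
    continuous_exp.continuousAt.mono_left nhdsWithin_le_nhds
  have h2 := (h1.mul tendsto_mul_expIntegralE1_zero).neg
  rw [mul_zero, neg_zero] at h2
  refine h2.congr' ?_
  filter_upwards [self_mem_nhdsWithin] with x (hx : 0 < x)
  rw [expMulEiNeg, Ei_neg hx]
  ring

/-- The logarithmic singularities cancel: the difference is `2 (sinh x E₁(x) + exp (-x) Shi(x))`,
where `sinh x E₁(x)` is `sinh x / x` times `x E₁(x)`. -/
theorem tendsto_expNegMulEi_sub_expMulEiNeg_zero :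
    Tendsto (fun x => expNegMulEi x - expMulEiNeg x) (𝓝[>] 0) (𝓝 0) := by
  have h1 : Tendsto (dslope sinh 0) (𝓝[>] 0) (𝓝 (dslope sinh 0 0)) :=
    continuous_dslope_sinh.continuousAt.mono_left nhdsWithin_le_nhds
  have h2 : Tendsto (fun x => exp (-x) * sinhIntegral x) (𝓝[>] 0) (𝓝 0) := by
    have : ContinuousAt (fun x => exp (-x) * sinhIntegral x) 0 :=
      ContinuousAt.mul (by fun_prop) (hasDerivAt_sinhIntegral 0).continuousAt
    simpa [ContinuousAt, sinhIntegral] using this.mono_left (nhdsWithin_le_nhds (s := Ioi 0))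
  have h3 := ((h1.mul tendsto_mul_expIntegralE1_zero).add h2).const_mul 2
  rw [mul_zero, add_zero, mul_zero] at h3
  refine h3.congr' ?_
  filter_upwards [self_mem_nhdsWithin] with x (hx : 0 < x)
  rw [expNegMulEi, expMulEiNeg, Ei_neg hx, Ei_of_pos hx, dslope_sinh_of_ne hx.ne', sinh_eq]
  field_simp
  ring

theorem tendsto_mul_expNegMulEi_zero : Tendsto (fun x => x * expNegMulEi x) (𝓝[>] 0) (𝓝 0) := by
  have h1 : Tendsto (fun x : ℝ => x) (𝓝[>] 0) (𝓝 0) := nhdsWithin_le_nhds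
  have h2 := (h1.mul tendsto_expNegMulEi_sub_expMulEiNeg_zero).add tendsto_mul_expMulEiNeg_zero
  rw [mul_zero, add_zero] at h2
  refine h2.congr fun x => ?_
  ring

/-! ### Differential relations of the sine transform -/

theorem mul_one_add_sq_rpow_neg_le (a u : ℝ) :
    u * (1 + u ^ 2) ^ (-a) ≤ (1 + u ^ 2) ^ (-(a - 1 / 2)) := by
  have h1 : 0 < 1 + u ^ 2 := by positivity
  have h2 : u ≤ (1 + u ^ 2) ^ (1 / 2 : ℝ) := by
    rw [← sqrt_eq_rpow]
    exact le_sqrt_of_sq_le (by linarith)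
  rw [show -(a - 1 / 2) = 1 / 2 + -a by ring, rpow_add h1]
  gcongr

/-- Here `u (1 + u ^ 2) ^ (-a)` is an exact derivative, and integrating by parts lowers `a` by one.
The bound on `a` makes the differentiated integrand absolutely integrable. -/
theorem hasDerivAt_sinInt {a : ℝ} (ha : 3 / 2 < a) (x : ℝ) :
    HasDerivAt (sinInt a) (∫ u in Ioi (0 : ℝ), cos (x * u) * u * (1 + u ^ 2) ^ (-a)) x ∧
      ∫ u in Ioi (0 : ℝ), cos (x * u) * u * (1 + u ^ 2) ^ (-a) =
        (1 - x * sinInt (a - 1) x) / (2 * (a - 1)) := by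
  have hsin : ∀ b : ℝ, 1 / 2 < b →
      IntegrableOn (fun u => sin (x * u) * (1 + u ^ 2) ^ (-b)) (Ioi 0) := fun b hb =>
    (integrable_mul_one_add_sq_rpow_neg hb (φ := fun u => sin (x * u)) (by fun_prop)
      fun u => abs_sin_le_one _).integrableOn
  have key := (hasDerivAt_integral_of_dominated_loc_of_deriv_le (μ := volume.restrict (Ioi (0 : ℝ)))
    (F := fun x u => sin (x * u) * (1 + u ^ 2) ^ (-a))
    (F' := fun x u => cos (x * u) * u * (1 + u ^ 2) ^ (-a))
    (bound := fun u => (1 + u ^ 2) ^ (-(a - 1 / 2))) (x₀ := x) (s := univ) univ_mem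
    (Eventually.of_forall fun y => by fun_prop) (hsin a (by linarith)) (by fun_prop) ?_
    (integrable_one_add_sq_rpow_neg (by linarith)).integrableOn ?_)
  · refine ⟨key.2, ?_⟩
    have hi := (hsin (a - 1) (by linarith)).const_mul (x / (2 * (a - 1)))
    have hi' : IntegrableOn (fun u => cos (x * u) * u * (1 + u ^ 2) ^ (-a) +
        x / (2 * (a - 1)) * (sin (x * u) * (1 + u ^ 2) ^ (-(a - 1)))) (Ioi 0) := by
      refine Integrable.add (f := fun u => cos (x * u) * u * (1 + u ^ 2) ^ (-a)) key.1 hi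
    have h := integral_Ioi_of_hasDerivAt_of_tendsto' (a := 0) (m := 0)
      (f := fun u => -(cos (x * u) * (1 + u ^ 2) ^ (-(a - 1))) / (2 * (a - 1)))
      (f' := fun u => cos (x * u) * u * (1 + u ^ 2) ^ (-a) +
        x / (2 * (a - 1)) * (sin (x * u) * (1 + u ^ 2) ^ (-(a - 1)))) (fun u _ => ?_)
      hi' ?_
    · rw [integral_add key.1 hi, integral_const_mul,
        mul_zero, cos_zero, zero_pow two_ne_zero, add_zero, one_rpow, neg_div, mul_one] at h
      rw [sub_div, mul_div_right_comm, sinInt]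
      linarith
    · have h1 : HasDerivAt (fun u => cos (x * u)) (-sin (x * u) * x) u := by
        simpa using ((hasDerivAt_id u).const_mul x).cos
      have h0 : 0 < 1 + u ^ 2 := by positivity
      have h2 : HasDerivAt (fun u : ℝ => (1 + u ^ 2) ^ (-(a - 1)))
          (2 * u * (-(a - 1)) * (1 + u ^ 2) ^ (-a)) u := by
        have := ((hasDerivAt_pow 2 u).const_add 1).rpow_const (p := -(a - 1)) (Or.inl h0.ne')
        refine this.congr_deriv ?_
        rw [show -(a - 1) - 1 = -a by ring]
        simp
      refine ((h1.mul h2).neg.div_const (2 * (a - 1))).congr_deriv ?_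
      have : a - 1 ≠ 0 := by linarith
      field_simp
      ring
    · have h1 : Tendsto (fun u : ℝ => (1 + u ^ 2) ^ (-(a - 1))) atTop (𝓝 0) :=
        (tendsto_rpow_neg_atTop (by linarith)).comp
          (tendsto_atTop_add_const_left _ 1 (tendsto_pow_atTop two_ne_zero))
      have h2 : Tendsto (fun u : ℝ => cos (x * u) * (1 + u ^ 2) ^ (-(a - 1))) atTop (𝓝 0) :=
        squeeze_zero_norm (fun u => by
          rw [norm_mul, Real.norm_of_nonneg (by positivity : 0 ≤ (1 + u ^ 2) ^ (-(a - 1)))]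
          exact mul_le_of_le_one_left (by positivity) (abs_cos_le_one _)) h1
      simpa using h2.neg.div_const (2 * (a - 1))
  · refine (ae_restrict_iff' measurableSet_Ioi).2 (ae_of_all _ fun u (hu : 0 < u) y _ => ?_)
    refine le_trans ?_ (mul_one_add_sq_rpow_neg_le _ u)
    rw [mul_assoc, norm_mul, Real.norm_of_nonneg (by positivity : 0 ≤ u * (1 + u ^ 2) ^ (-a))]
    exact mul_le_of_le_one_left (by positivity) (abs_cos_le_one _)
  · refine ae_of_all _ fun u y _ => ?_
    simpa only [id, one_mul] using
      (((hasDerivAt_id y).mul_const u).sin).mul_const ((1 + u ^ 2) ^ (-a))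

theorem hasDerivAt_sinInt_of_lt {a : ℝ} (ha : 3 / 2 < a) (x : ℝ) :
    HasDerivAt (sinInt a) ((1 - x * sinInt (a - 1) x) / (2 * (a - 1))) x :=
  (hasDerivAt_sinInt ha x).2 ▸ (hasDerivAt_sinInt ha x).1

theorem abs_sinInt_le {a : ℝ} (ha : 1 / 2 < a) (x : ℝ) :
    |sinInt a x| ≤ ∫ u in Ioi (0 : ℝ), (1 + u ^ 2) ^ (-a) := by
  rw [sinInt, ← Real.norm_eq_abs]
  refine norm_integral_le_of_norm_le (integrable_one_add_sq_rpow_neg ha).integrableOn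
    (ae_of_all _ fun u => ?_)
  rw [norm_mul, Real.norm_of_nonneg (by positivity : 0 ≤ (1 + u ^ 2) ^ (-a))]
  exact mul_le_of_le_one_left (by positivity) (abs_sin_le_one _)

theorem continuous_sinInt {a : ℝ} (ha : 1 / 2 < a) : Continuous (sinInt a) := by
  change Continuous fun x => ∫ u in Ioi (0 : ℝ), sin (x * u) * (1 + u ^ 2) ^ (-a)
  refine continuous_of_dominated (bound := fun u => (1 + u ^ 2) ^ (-a)) (fun x => by fun_prop)
    (fun x => ae_of_all _ fun u => ?_) (integrable_one_add_sq_rpow_neg ha).integrableOn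
    (ae_of_all _ fun u => by fun_prop)
  rw [norm_mul, Real.norm_of_nonneg (by positivity : 0 ≤ (1 + u ^ 2) ^ (-a))]
  exact mul_le_of_le_one_left (by positivity) (abs_sin_le_one _)

theorem sinInt_zero (a : ℝ) : sinInt a 0 = 0 := by simp [sinInt]

theorem tendsto_sinInt_zero {a : ℝ} (ha : 1 / 2 < a) : Tendsto (sinInt a) (𝓝[>] 0) (𝓝 0) := by
  have h := (continuous_sinInt ha).continuousAt (x := 0)
  rw [ContinuousAt, sinInt_zero] at h
  exact h.mono_left nhdsWithin_le_nhds

/-- For `a = 1` the differentiated integrand is not absolutely integrable. Instead `sinInt 1` is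
recovered from the derivative `g` of `sinInt 2` as `(1 - 2 g) / x`, and `g` can be differentiated
under the integral. -/
theorem hasDerivAt_sinInt_one {x : ℝ} (hx : 0 < x) :
    HasDerivAt (sinInt 1) ((sinInt 1 x - 2 * sinInt 2 x) / x) x := by
  set g : ℝ → ℝ := fun x => ∫ u in Ioi (0 : ℝ), cos (x * u) * u * (1 + u ^ 2) ^ (-2 : ℝ) with hg
  have hgeq : ∀ y, g y = (1 - y * sinInt 1 y) / 2 := fun y => by
    have := (hasDerivAt_sinInt (a := 2) (by norm_num) y).2
    norm_num at this
    simpa [hg] using this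
  have hcos : Integrable (fun u : ℝ => cos (x * u) * u * (1 + u ^ 2) ^ (-2 : ℝ))
      (volume.restrict (Ioi 0)) := by
    refine (integrable_one_add_sq_rpow_neg (a := 2 - 1 / 2) (by norm_num)).integrableOn.mono'
      (by fun_prop) ?_
    refine (ae_restrict_iff' measurableSet_Ioi).2 (ae_of_all _ fun u (hu : 0 < u) => ?_)
    refine le_trans ?_ (mul_one_add_sq_rpow_neg_le _ u)
    rw [mul_assoc, norm_mul, Real.norm_of_nonneg (by positivity : 0 ≤ u * (1 + u ^ 2) ^ (-2 : ℝ))]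
    exact mul_le_of_le_one_left (by positivity) (abs_cos_le_one _)
  have hsin : ∀ b : ℝ, 1 / 2 < b →
      IntegrableOn (fun u => sin (x * u) * (1 + u ^ 2) ^ (-b)) (Ioi 0) := fun b hb =>
    (integrable_mul_one_add_sq_rpow_neg hb (φ := fun u => sin (x * u)) (by fun_prop)
      fun u => abs_sin_le_one _).integrableOn
  have hsq : ∀ u : ℝ, u ^ 2 * (1 + u ^ 2) ^ (-2 : ℝ) =
      (1 + u ^ 2) ^ (-1 : ℝ) - (1 + u ^ 2) ^ (-2 : ℝ) := by
    intro u
    have h0 : 0 < 1 + u ^ 2 := by positivity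
    rw [show (-1 : ℝ) = -2 + 1 by norm_num, rpow_add_one h0.ne']
    ring
  have key := (hasDerivAt_integral_of_dominated_loc_of_deriv_le (μ := volume.restrict (Ioi (0 : ℝ)))
    (F := fun x u => cos (x * u) * u * (1 + u ^ 2) ^ (-2 : ℝ))
    (F' := fun x u => -(sin (x * u) * (u ^ 2 * (1 + u ^ 2) ^ (-2 : ℝ))))
    (bound := fun u => (1 + u ^ 2) ^ (-1 : ℝ)) (x₀ := x) (s := univ) univ_mem
    (Eventually.of_forall fun y => by fun_prop) hcos (by fun_prop) ?_
    (integrable_one_add_sq_rpow_neg (by norm_num)).integrableOn ?_).2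
  · have hval : ∫ u in Ioi (0 : ℝ), -(sin (x * u) * (u ^ 2 * (1 + u ^ 2) ^ (-2 : ℝ))) =
        sinInt 2 x - sinInt 1 x := by
      rw [sinInt, sinInt, ← integral_sub (hsin 2 (by norm_num)) (hsin 1 (by norm_num))]
      congr 1
      funext u
      rw [hsq]
      ring
    rw [hval] at key
    have hd : HasDerivAt (fun y => (1 - 2 * g y) / y)
        (((0 - 2 * (sinInt 2 x - sinInt 1 x)) * x - (1 - 2 * g x) * 1) / x ^ 2) x :=
      ((hasDerivAt_const x 1).sub (key.const_mul 2)).div (hasDerivAt_id x) hx.ne'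
    refine (hd.congr_of_eventuallyEq ?_).congr_deriv ?_
    · filter_upwards [Ioi_mem_nhds hx] with y (hy : 0 < y)
      rw [hgeq]
      field_simp
      ring
    · rw [hgeq]
      field_simp
      ring
  · refine ae_of_all _ fun u y _ => ?_
    have h0 : 0 ≤ u ^ 2 * (1 + u ^ 2) ^ (-2 : ℝ) := by positivity
    have h1 : 0 ≤ (1 + u ^ 2) ^ (-2 : ℝ) := by positivity
    rw [norm_neg, norm_mul, Real.norm_of_nonneg h0]
    exact (mul_le_of_le_one_left h0 (abs_sin_le_one _)).trans (by rw [hsq]; linarith)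
  · refine ae_of_all _ fun u y _ => ?_
    refine (((((hasDerivAt_id y).mul_const u).cos).mul_const u).mul_const
      ((1 + u ^ 2) ^ (-2 : ℝ))).congr_deriv ?_
    simp only [id]
    ring

/-- The second-order equation `f'' = f - 1 / x` is solved in two first-order steps. The function `w
= f' + f` satisfies `w' = w - 1 / x`, as does `-expMulEiNeg`; they agree because a difference
growing like `exp` is excluded by boundedness at infinity. The remaining equation for `f` is fixed
by the limit `0` at `0`. -/
theorem sinInt_one {x : ℝ} (hx : 0 < x) :
    sinInt 1 x = (expNegMulEi x - expMulEiNeg x) / 2 := by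
  set w : ℝ → ℝ := fun y => (sinInt 1 y - 2 * sinInt 2 y) / y + sinInt 1 y with hw
  have hwd : ∀ y, 0 < y → HasDerivAt w (w y - 1 / y) y := by
    intro y hy
    have h1 := hasDerivAt_sinInt_one hy
    have h2 := hasDerivAt_sinInt_of_lt (a := 2) (by norm_num) y
    refine (((h1.sub (h2.const_mul 2)).div (hasDerivAt_id y) hy.ne').add h1).congr_deriv ?_
    norm_num [hw]
    field_simp
    ring
  have hδ : ∀ y, 0 < y → w y + expMulEiNeg y = 0 := by
    set δ : ℝ → ℝ := fun y => exp (-y) * (w y + expMulEiNeg y) with hδdef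
    have hδd : ∀ y, 0 < y → HasDerivAt δ 0 y := fun y hy => by
      refine ((hasDerivAt_neg y).exp.mul
        ((hwd y hy).add (hasDerivAt_expMulEiNeg hy))).congr_deriv ?_
      simp only [Pi.add_apply]
      ring
    have hlim : Tendsto δ atTop (𝓝 0) := by
      set C₁ := ∫ u in Ioi (0 : ℝ), (1 + u ^ 2) ^ (-1 : ℝ)
      set C₂ := ∫ u in Ioi (0 : ℝ), (1 + u ^ 2) ^ (-2 : ℝ)
      refine squeeze_zero_norm' (a := fun y => exp (-y) * (2 * C₁ + 2 * C₂ + 1)) ?_ ?_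
      · filter_upwards [eventually_ge_atTop 1] with y hy
        have hy0 : 0 < y := by linarith
        have b1 := abs_le.1 (abs_sinInt_le (a := 1) (by norm_num) y)
        have b2 := abs_le.1 (abs_sinInt_le (a := 2) (by norm_num) y)
        have b3 := exp_mul_expIntegralE1_le_one hy
        have b4 := mul_nonneg (exp_pos y).le (expIntegralE1_nonneg hy0)
        have b5 : |(sinInt 1 y - 2 * sinInt 2 y) / y| ≤ C₁ + 2 * C₂ := by
          rw [abs_div, abs_of_pos hy0]
          refine (div_le_self (abs_nonneg _) hy).trans (abs_le.2 ⟨?_, ?_⟩) <;> linarith [b1.1, b2.1]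
        have b6 := abs_le.1 b5
        rw [norm_mul, Real.norm_of_nonneg (exp_pos _).le]
        refine mul_le_mul_of_nonneg_left ?_ (exp_pos _).le
        rw [Real.norm_eq_abs, hw, expMulEiNeg, Ei_neg hy0, abs_le]
        constructor <;> simp only [mul_neg] <;> linarith [b1.1, b1.2, b6.1, b6.2]
      · simpa using (tendsto_exp_neg_atTop_nhds_zero).mul_const (2 * C₁ + 2 * C₂ + 1)
    intro y hy
    have hc : ∀ z ∈ Ioi (0 : ℝ), δ z = δ y := fun z hz =>
      isOpen_Ioi.is_const_of_deriv_eq_zero isPreconnected_Ioi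
        (fun z hz => (hδd z hz).differentiableAt.differentiableWithinAt)
        (fun z hz => (hδd z hz).deriv) hz hy
    have h0 : δ y = 0 := tendsto_nhds_unique ((tendsto_const_nhds (x := δ y)).congr'
      (by filter_upwards [eventually_gt_atTop 0] with z hz using (hc z hz).symm)) hlim
    exact (mul_eq_zero.1 h0).resolve_left (exp_pos _).ne'
  have h := eq_zero_of_hasDerivAt_zero
    (fun y => exp y * (sinInt 1 y - (expNegMulEi y - expMulEiNeg y) / 2)) (fun y hy => ?_) ?_ x hx
  · have := (mul_eq_zero.1 h).resolve_left (exp_pos _).ne'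
    linarith
  · have h1 := hasDerivAt_sinInt_one hy
    refine ((hasDerivAt_exp y).mul (h1.sub (((hasDerivAt_expNegMulEi hy).sub
      (hasDerivAt_expMulEiNeg hy)).div_const 2))).congr_deriv ?_
    have h2 := hδ y hy
    simp only [hw] at h2
    have h3 : (sinInt 1 y - 2 * sinInt 2 y) / y = -expMulEiNeg y - sinInt 1 y := by linarith
    simp only [Pi.sub_apply]
    rw [h3]
    ring
  · have h1 : Tendsto exp (𝓝[>] 0) (𝓝 (exp 0)) :=
      continuous_exp.continuousAt.mono_left nhdsWithin_le_nhds
    simpa using h1.mul ((tendsto_sinInt_zero (a := 1) (by norm_num)).sub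
      (tendsto_expNegMulEi_sub_expMulEiNeg_zero.div_const 2))

/-! ### The sine transform at positive integers -/

/-- `x ^ m exp (-x) Ei x` minus the polynomial part of its asymptotic expansion. -/
noncomputable def eiPos : ℕ → ℝ → ℝ
  | 0, x => expNegMulEi x
  | m + 1, x => x * eiPos m x - (Nat.factorial m : ℝ)

/-- `(-1) ^ (m + 1) x ^ m exp x Ei (-x)` minus the polynomial part of its asymptotic expansion. -/
noncomputable def eiNeg : ℕ → ℝ → ℝ
  | 0, x => -expMulEiNeg x
  | m + 1, x => -x * eiNeg m x + (Nat.factorial m : ℝ)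

theorem eiPos_eq (m : ℕ) (x : ℝ) : eiPos m x = x ^ m * expNegMulEi x -
    ∑ i ∈ Finset.range m, (Nat.factorial i : ℝ) * x ^ (m - 1 - i) := by
  induction m with
  | zero => simp [eiPos]
  | succ m ih =>
    rw [eiPos, ih, Finset.sum_range_succ, mul_sub, Finset.mul_sum, Nat.add_sub_cancel,
      Nat.sub_self, pow_zero, mul_one, pow_succ']
    rw [Finset.sum_congr rfl fun i hi => show x * ((Nat.factorial i : ℝ) * x ^ (m - 1 - i)) =
      (Nat.factorial i : ℝ) * x ^ (m - i) by
        have := Finset.mem_range.1 hi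
        rw [show m - i = m - 1 - i + 1 by omega, pow_succ]
        ring]
    ring

theorem eiNeg_eq (m : ℕ) (x : ℝ) : eiNeg m x = (-1) ^ (m + 1) * x ^ m * expMulEiNeg x -
    ∑ i ∈ Finset.range m, (Nat.factorial i : ℝ) * (-1) ^ (m + i) * x ^ (m - 1 - i) := by
  induction m with
  | zero => simp [eiNeg]
  | succ m ih =>
    rw [eiNeg, ih, Finset.sum_range_succ, mul_sub, Finset.mul_sum, Nat.add_sub_cancel,
      Nat.sub_self, pow_zero, mul_one, show m + 1 + m = 2 * m + 1 by ring,
      (odd_two_mul_add_one m).neg_one_pow]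
    rw [Finset.sum_congr rfl fun i hi =>
      show -x * ((Nat.factorial i : ℝ) * (-1) ^ (m + i) * x ^ (m - 1 - i)) =
        (Nat.factorial i : ℝ) * (-1) ^ (m + 1 + i) * x ^ (m - i) by
        have := Finset.mem_range.1 hi
        rw [show m - i = m - 1 - i + 1 by omega, pow_succ, show m + 1 + i = m + i + 1 by ring,
          pow_succ]
        ring]
    ring

theorem hasDerivAt_eiPos_succ (m : ℕ) {x : ℝ} (hx : 0 < x) :
    HasDerivAt (eiPos (m + 1)) ((m + 1) * eiPos m x - eiPos (m + 1) x) x := by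
  induction m with
  | zero =>
    refine (((hasDerivAt_id x).mul (hasDerivAt_expNegMulEi hx)).sub_const 1).congr_deriv ?_
      |>.congr_of_eventuallyEq (Eventually.of_forall fun y => by simp [eiPos])
    simp [eiPos]
    field_simp
    ring
  | succ m ih =>
    refine (((hasDerivAt_id x).mul ih).sub_const ((m + 1).factorial : ℝ)).congr_deriv ?_
    simp only [eiPos, id, Nat.factorial_succ]
    push_cast
    ring

theorem hasDerivAt_eiNeg_succ (m : ℕ) {x : ℝ} (hx : 0 < x) :
    HasDerivAt (eiNeg (m + 1)) (-(m + 1) * eiNeg m x + eiNeg (m + 1) x) x := by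
  induction m with
  | zero =>
    refine (((hasDerivAt_neg x).mul (hasDerivAt_expMulEiNeg hx).neg).add_const 1).congr_deriv ?_
      |>.congr_of_eventuallyEq (Eventually.of_forall fun y => by simp [eiNeg])
    simp [eiNeg]
    field_simp
    ring
  | succ m ih =>
    refine (((hasDerivAt_neg x).mul ih).add_const ((m + 1).factorial : ℝ)).congr_deriv ?_
    simp only [eiNeg, Nat.factorial_succ]
    push_cast
    ring

/-- For `m = 0` the terms `1 / x` of the two derivatives cancel, and the truncated `m - 1` is
harmless because its factor is `0`. -/
theorem hasDerivAt_eiPos_add_eiNeg (m : ℕ) {x : ℝ} (hx : 0 < x) :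
    HasDerivAt (fun y => eiPos m y + eiNeg m y)
      (m * (eiPos (m - 1) x - eiNeg (m - 1) x) - (eiPos m x - eiNeg m x)) x := by
  cases m with
  | zero =>
    refine ((hasDerivAt_expNegMulEi hx).add (hasDerivAt_expMulEiNeg hx).neg).congr_deriv ?_
    simp [eiPos, eiNeg]
    ring
  | succ m =>
    refine ((hasDerivAt_eiPos_succ m hx).add (hasDerivAt_eiNeg_succ m hx)).congr_deriv ?_
    rw [Nat.add_sub_cancel]
    push_cast
    ring

theorem tendsto_eiPos_succ_zero (m : ℕ) :
    Tendsto (eiPos (m + 1)) (𝓝[>] 0) (𝓝 (-(m.factorial : ℝ))) := by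
  induction m with
  | zero =>
    have h := tendsto_mul_expNegMulEi_zero.sub_const 1
    simpa [eiPos] using! h
  | succ m ih =>
    have h1 : Tendsto (fun x : ℝ => x) (𝓝[>] 0) (𝓝 0) := nhdsWithin_le_nhds
    have h := (h1.mul ih).sub_const ((m + 1).factorial : ℝ)
    rw [zero_mul, zero_sub] at h
    exact h

theorem tendsto_eiNeg_succ_zero (m : ℕ) :
    Tendsto (eiNeg (m + 1)) (𝓝[>] 0) (𝓝 (m.factorial : ℝ)) := by
  induction m with
  | zero =>
    have h := tendsto_mul_expMulEiNeg_zero.add_const 1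
    simpa [eiNeg] using! h
  | succ m ih =>
    have h1 : Tendsto (fun x : ℝ => -x) (𝓝[>] 0) (𝓝 (-0)) :=
      (continuous_neg.tendsto 0).mono_left nhdsWithin_le_nhds
    have h := (h1.mul ih).add_const ((m + 1).factorial : ℝ)
    rw [neg_zero, zero_mul, zero_add] at h
    exact h

theorem tendsto_eiPos_add_eiNeg_zero (m : ℕ) :
    Tendsto (fun x => eiPos m x + eiNeg m x) (𝓝[>] 0) (𝓝 0) := by
  cases m with
  | zero => simpa [eiPos, eiNeg, sub_eq_add_neg] using tendsto_expNegMulEi_sub_expMulEiNeg_zero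
  | succ m => simpa using (tendsto_eiPos_succ_zero m).add (tendsto_eiNeg_succ_zero m)

/-- Pascal's rule expresses the next sum by the present one plus half of itself; the two boundary
terms cancel because `(2 * M + 2).choose (M + 1)` is twice `(2 * M + 1).choose M`. -/
theorem sum_choose_add_mul_inv_two_pow (M : ℕ) :
    ∑ i ∈ Finset.range (M + 1), ((M + i).choose M : ℝ) * (1 / 2) ^ i = 2 ^ M := by
  induction M with
  | zero => simp
  | succ M ih =>
    set S := ∑ i ∈ Finset.range (M + 2), ((M + 1 + i).choose (M + 1) : ℝ) * (1 / 2) ^ i with hS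
    have h1 : S = (∑ i ∈ Finset.range (M + 2), ((M + i).choose M : ℝ) * (1 / 2) ^ i) +
        ∑ i ∈ Finset.range (M + 2), ((M + i).choose (M + 1) : ℝ) * (1 / 2) ^ i := by
      rw [hS, ← Finset.sum_add_distrib]
      refine Finset.sum_congr rfl fun i _ => ?_
      rw [show M + 1 + i = M + i + 1 by ring, Nat.choose_succ_succ]
      push_cast
      ring
    have h2 : ∑ i ∈ Finset.range (M + 2), ((M + i).choose (M + 1) : ℝ) * (1 / 2) ^ i =
        1 / 2 * (S - ((2 * M + 2).choose (M + 1) : ℝ) * (1 / 2) ^ (M + 1)) := by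
      rw [Finset.sum_range_succ', hS, Finset.sum_range_succ _ (M + 1),
        show M + 1 + (M + 1) = 2 * M + 2 by ring, add_sub_cancel_right, Finset.mul_sum, add_zero,
        Nat.choose_succ_self, Nat.cast_zero, zero_mul, add_zero]
      refine Finset.sum_congr rfl fun i _ => ?_
      rw [show M + (i + 1) = M + 1 + i by ring, pow_succ]
      ring
    have h3 : ((2 * M + 2).choose (M + 1) : ℝ) = 2 * ((2 * M + 1).choose M : ℝ) := by
      rw [Nat.choose_succ_succ (2 * M + 1) M, Nat.choose_symm_half]
      push_cast
      ring
    rw [Finset.sum_range_succ, ih, show M + (M + 1) = 2 * M + 1 by ring] at h1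
    rw [h2, h3] at h1
    rw [pow_succ]
    linarith

/-- The coefficients of the finite expansion of the sine transform at positive integers. -/
noncomputable def oddCoeff (N m : ℕ) : ℝ :=
  ((2 * N - m).choose N : ℝ) * 2 ^ m / (2 ^ (2 * N + 1) * (m.factorial : ℝ))

/-- For `N = 0` the truncated `2 * N - m` would give `Nat.choose 0 0 = 1`. -/
theorem oddCoeff_eq_zero {N m : ℕ} (hN : 1 ≤ N) (hm : N < m) : oddCoeff N m = 0 := by
  rw [oddCoeff, Nat.choose_eq_zero_of_lt (by omega)]
  simp

theorem oddCoeff_one_eq_oddCoeff_zero {N : ℕ} (hN : 1 ≤ N) : oddCoeff N 1 = oddCoeff N 0 := by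
  obtain ⟨M, rfl⟩ := Nat.exists_eq_add_of_le' hN
  have h3 : ((2 * (M + 1)).choose (M + 1) : ℝ) = 2 * ((2 * (M + 1) - 1).choose (M + 1) : ℝ) := by
    rw [show 2 * (M + 1) = 2 * M + 1 + 1 by ring, Nat.choose_succ_succ (2 * M + 1) M,
      Nat.add_sub_cancel, Nat.choose_symm_half]
    push_cast
    ring
  rw [oddCoeff, oddCoeff, Nat.sub_zero, h3]
  simp
  ring

/-- This matches the coefficients of `eiPos (m + 1) - eiNeg (m + 1)` when the finite sum is
differentiated; `2 * (N + 1)` is `2 (a - 1)` for `a = N + 2`. -/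
theorem oddCoeff_rec {N m : ℕ} (hm : m ≤ N) :
    ((m + 1 : ℕ) + 1 : ℝ) * oddCoeff (N + 1) (m + 2) - oddCoeff (N + 1) (m + 1) =
      -oddCoeff N m / (2 * (N + 1)) := by
  obtain ⟨p, hp⟩ : ∃ p, p = 2 * N - m := ⟨_, rfl⟩
  have e1 : 2 * (N + 1) - (m + 2) = p := by omega
  have e2 : 2 * (N + 1) - (m + 1) = p + 1 := by omega
  have h1 : (p.choose (N + 1) : ℝ) * (N + 1) = p.choose N * (N - m) := by
    have h := Nat.choose_succ_right_eq p N
    have h' : ((p - N : ℕ) : ℝ) = N - m := by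
      rw [show p - N = N - m by omega, Nat.cast_sub hm]
    rw [← h']
    exact_mod_cast h
  have hf := Nat.factorial_pos m
  have h2 : (p.choose (N + 1) : ℝ) = p.choose N * (N - m) / (N + 1) := by
    rw [← h1]; field_simp
  rw [oddCoeff, oddCoeff, oddCoeff, e1, e2, ← hp, Nat.choose_succ_succ, Nat.factorial_succ (m + 1),
    Nat.factorial_succ m]
  push_cast
  rw [h2, show 2 * (N + 1) + 1 = 2 * N + 1 + 2 by ring, pow_add 2 (2 * N + 1), pow_add 2 m,
    pow_add 2 m]
  field_simp
  ring

/-- It supplies the constant `1` in the derivative formula for `sinInt`. -/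
theorem sum_oddCoeff_mul_factorial (N : ℕ) :
    ∑ m ∈ Finset.range (N + 1), 2 * oddCoeff N m * (m.factorial : ℝ) = 1 := by
  rw [← Finset.sum_range_reflect]
  have h : ∀ i ∈ Finset.range (N + 1), 2 * oddCoeff N (N + 1 - 1 - i) *
      ((N + 1 - 1 - i).factorial : ℝ) = (2 ^ N)⁻¹ * (((N + i).choose N : ℝ) * (1 / 2) ^ i) := by
    intro i hi
    have hi' : i ≤ N := Nat.lt_succ_iff.1 (Finset.mem_range.1 hi)
    obtain ⟨j, rfl⟩ := Nat.exists_eq_add_of_le hi'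
    rw [oddCoeff, show i + j + 1 - 1 - i = j by omega,
      show 2 * (i + j) - j = i + j + i by omega]
    have hf := Nat.factorial_pos j
    rw [show 2 * (i + j) + 1 = i + j + i + j + 1 by ring]
    simp only [pow_add, one_div, inv_pow]
    field_simp
  rw [Finset.sum_congr rfl h, ← Finset.mul_sum, sum_choose_add_mul_inv_two_pow,
    inv_mul_cancel₀ (by positivity)]

/-- Both sides tend to `0` at `0`, so it suffices to compare derivatives; on the left the derivative
is known from the previous `N`. -/
theorem sinInt_natCast_add_one (N : ℕ) {x : ℝ} (hx : 0 < x) : sinInt ((N : ℝ) + 1) x =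
    ∑ m ∈ Finset.range (N + 1), oddCoeff N m * (eiPos m x + eiNeg m x) := by
  induction N generalizing x with
  | zero =>
    rw [Nat.cast_zero, zero_add, sinInt_one hx]
    simp [oddCoeff, eiPos, eiNeg]
    ring
  | succ N ih =>
    refine sub_eq_zero.1 (eq_zero_of_hasDerivAt_zero (fun x => sinInt ((N + 1 : ℕ) + 1) x -
      ∑ m ∈ Finset.range (N + 1 + 1), oddCoeff (N + 1) m * (eiPos m x + eiNeg m x))
      (fun y hy => ?_) ?_ x hx)
    · have hN : (0 : ℝ) ≤ N := N.cast_nonneg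
      have h1 := hasDerivAt_sinInt_of_lt (a := (N + 1 : ℕ) + 1) (by push_cast; linarith) y
      have h2 := HasDerivAt.fun_sum (u := Finset.range (N + 1 + 1)) fun m _ =>
        (hasDerivAt_eiPos_add_eiNeg m hy).const_mul (oddCoeff (N + 1) m)
      refine (h1.sub h2).congr_deriv ?_
      rw [sub_eq_zero, add_sub_cancel_right]
      push_cast
      rw [ih hy]
      -- An index shift collects the coefficient of each `eiPos m - eiNeg m`; the extra top
      -- coefficient is zero.
      have hsplit : ∑ m ∈ Finset.range (N + 1 + 1), oddCoeff (N + 1) m *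
          (m * (eiPos (m - 1) y - eiNeg (m - 1) y) - (eiPos m y - eiNeg m y)) =
          ∑ m ∈ Finset.range (N + 1 + 1), ((m + 1) * oddCoeff (N + 1) (m + 1) -
            oddCoeff (N + 1) m) * (eiPos m y - eiNeg m y) := by
        have e1 : ∑ m ∈ Finset.range (N + 1 + 1), oddCoeff (N + 1) m *
            (m * (eiPos (m - 1) y - eiNeg (m - 1) y)) =
            ∑ m ∈ Finset.range (N + 1 + 1), (m + 1) * oddCoeff (N + 1) (m + 1) *
              (eiPos m y - eiNeg m y) := by
          rw [Finset.sum_range_succ', Finset.sum_range_succ _ (N + 1),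
            oddCoeff_eq_zero (by omega) (by omega : N + 1 < N + 1 + 1)]
          simp only [Nat.cast_zero, zero_mul, mul_zero, add_zero]
          refine Finset.sum_congr rfl fun m _ => ?_
          rw [Nat.add_sub_cancel]
          push_cast
          ring
        simp only [mul_sub, sub_mul, Finset.sum_sub_distrib] at e1 ⊢
        linarith
      rw [hsplit, Finset.sum_range_succ' _ (N + 1), Nat.cast_zero, zero_add, one_mul,
        oddCoeff_one_eq_oddCoeff_zero (by omega), sub_self, zero_mul, add_zero]
      have hstep : ∀ m ∈ Finset.range (N + 1), (((m + 1 : ℕ) + 1) * oddCoeff (N + 1) (m + 1 + 1) -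
          oddCoeff (N + 1) (m + 1)) * (eiPos (m + 1) y - eiNeg (m + 1) y) =
          (2 * oddCoeff N m * m.factorial - y * (oddCoeff N m * (eiPos m y + eiNeg m y))) /
            (2 * (N + 1)) := by
        intro m hm
        -- The recursions give `eiPos (m + 1) - eiNeg (m + 1) = y (eiPos m + eiNeg m) - 2 m!`.
        rw [oddCoeff_rec (Nat.lt_succ_iff.1 (Finset.mem_range.1 hm)), eiPos, eiNeg]
        ring
      rw [Finset.sum_congr rfl hstep, ← Finset.sum_div, Finset.sum_sub_distrib,
        sum_oddCoeff_mul_factorial, Finset.mul_sum]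
    · have h2 := tendsto_finsetSum (Finset.range (N + 1 + 1)) fun m _ =>
        (tendsto_eiPos_add_eiNeg_zero m).const_mul (oddCoeff (N + 1) m)
      have hN : (0 : ℝ) ≤ N := N.cast_nonneg
      simpa using (tendsto_sinInt_zero (a := (N + 1 : ℕ) + 1) (by push_cast; linarith)).sub h2

/-- A reindexing with `N = n - 1` and `m = k - 1`; the factor `1 + (-1) ^ (k + j)` arises from
adding the polynomial parts of `eiPos` and `eiNeg`. -/
theorem sinInt_natCast {n : ℕ} (hn : 1 ≤ n) {x : ℝ} (hx : 0 < x) : sinInt n x =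
    ∑ k ∈ Finset.Icc 1 n, ((2 * n - 1 - k).choose (n - 1) : ℝ) *
      ((2 : ℝ) ^ ((k : ℝ) - (2 * n - 1) - 1) / (Nat.factorial (k - 1) : ℝ)) *
      (x ^ (k - 1) * (exp (-x) * Ei x + (-1) ^ k * exp x * Ei (-x)) -
        ∑ j ∈ Finset.Icc 1 (k - 1),
          (Nat.factorial (j - 1) : ℝ) * (1 + (-1) ^ (k + j)) * x ^ (k - j - 1)) := by
  have hIcc : ∀ (m : ℕ) (f : ℕ → ℝ),
      ∑ k ∈ Finset.Icc 1 m, f k = ∑ i ∈ Finset.range m, f (i + 1) := fun m f => by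
    rw [Finset.range_eq_Ico, Finset.sum_Ico_add' f 0 m 1, zero_add]
    rfl
  obtain ⟨N, rfl⟩ := Nat.exists_eq_add_of_le' hn
  rw [Nat.cast_add_one, sinInt_natCast_add_one N hx, hIcc]
  refine Finset.sum_congr rfl fun m hm => ?_
  rw [hIcc, Nat.add_sub_cancel, Nat.add_sub_cancel, eiPos_eq, eiNeg_eq, oddCoeff,
    show 2 * (N + 1) - 1 - (m + 1) = 2 * N - m by omega]
  have hpow : (2 : ℝ) ^ (((m + 1 : ℕ) : ℝ) - (2 * ((N : ℝ) + 1) - 1) - 1) =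
      2 ^ m / 2 ^ (2 * N + 1) := by
    rw [← rpow_natCast, ← rpow_natCast, ← rpow_sub two_pos]
    push_cast
    ring_nf
  rw [hpow]
  have hsum : ∑ i ∈ Finset.range m, (Nat.factorial (i + 1 - 1) : ℝ) *
      (1 + (-1) ^ (m + 1 + (i + 1))) * x ^ (m + 1 - (i + 1) - 1) =
      ∑ i ∈ Finset.range m, (Nat.factorial i : ℝ) * x ^ (m - 1 - i) +
        ∑ i ∈ Finset.range m, (Nat.factorial i : ℝ) * (-1) ^ (m + i) * x ^ (m - 1 - i) := by
    rw [← Finset.sum_add_distrib]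
    refine Finset.sum_congr rfl fun i _ => ?_
    rw [Nat.add_sub_cancel, show m + 1 - (i + 1) - 1 = m - 1 - i by omega,
      show m + 1 + (i + 1) = m + i + 2 by ring, pow_add (-1) (m + i) 2]
    ring
  rw [hsum, expNegMulEi, expMulEiNeg]
  field_simp
  ring

/-! ### The functions `𝒜` and `ℬ` as trigonometric integrals -/

theorem cosInt_neg (a x : ℝ) : cosInt a (-x) = cosInt a x := by
  simp [cosInt]

theorem sinInt_neg (a x : ℝ) : sinInt a (-x) = -sinInt a x := by
  simp [sinInt, integral_neg]

theorem funA_eq (β : ℝ) {c ν : ℝ} (hc : 0 < c) (hν : 0 < ν) (t : ℝ) :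
    funA β c ν t = β * (2 * Gamma ((ν + 1) / 2) / (√π * Gamma (ν / 2))) *
      cosInt ((ν + 1) / 2) (2 * c * √ν * t) := by
  have hpi : 0 < √π := sqrt_pos.2 pi_pos
  have hG1 := Gamma_pos_of_pos (by positivity : 0 < (ν + 1) / 2)
  have hG2 := Gamma_pos_of_pos (half_pos hν)
  rw [cosInt_eq (by linarith), show (ν + 1) / 2 - 1 / 2 = ν / 2 by ring, funA]
  split_ifs with ht
  · rw [ht, mul_zero, zero_pow two_ne_zero, zero_div, macdonaldInt_zero _ (half_pos hν)]
    field_simp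
  · have hx : 0 < 2 * c * √ν * |t| := by
      have := abs_pos.2 ht
      have := sqrt_pos.2 hν
      positivity
    rw [show (2 * c * √ν * t) ^ 2 = (2 * c * √ν * |t|) ^ 2 by rw [mul_pow, mul_pow _ |t|, sq_abs],
      macdonaldInt_sq_div_four _ hx, show 2 * c * √ν * |t| / 2 = c * √ν * |t| by ring]
    field_simp

/-- One-sided continuity of `macdonaldInt` at `0` suffices, since its argument is a nonnegative
square. -/
theorem continuousAt_funA (β : ℝ) {c ν : ℝ} (hc : 0 < c) (hν : 0 < ν) :
    ContinuousAt (funA β c ν) 0 := by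
  have h1 : funA β c ν = fun t => β * (2 * Gamma ((ν + 1) / 2) / (√π * Gamma (ν / 2))) *
      (√π / (2 * Gamma ((ν + 1) / 2)) * macdonaldInt (ν / 2) ((2 * c * √ν * t) ^ 2 / 4)) := by
    funext t
    rw [funA_eq β hc hν, cosInt_eq (by linarith), show (ν + 1) / 2 - 1 / 2 = ν / 2 by ring]
  rw [h1]
  refine ContinuousAt.mul continuousAt_const (ContinuousAt.mul continuousAt_const ?_)
  have h2 : ContinuousAt (fun t : ℝ => (2 * c * √ν * t) ^ 2 / 4) 0 := by fun_prop
  have h3 : Tendsto (fun t : ℝ => (2 * c * √ν * t) ^ 2 / 4) (𝓝 0) (𝓝[≥] 0) :=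
    tendsto_nhdsWithin_iff.2 ⟨by simpa [ContinuousAt] using h2, Eventually.of_forall fun t => by
      simp only [mem_Ici]; positivity⟩
  have h4 := (continuousWithinAt_macdonaldInt_zero (half_pos hν)).tendsto.comp h3
  simpa [ContinuousAt, Function.comp_def] using h4

theorem sinInt_mul_eq_sign_mul (a r t : ℝ) : sinInt a (r * t) = Real.sign t * sinInt a (r * |t|) := by
  rcases lt_trichotomy t 0 with h | rfl | h
  · rw [Real.sign_of_neg h, abs_of_neg h, mul_neg, sinInt_neg]
    ring
  · simp [sinInt_zero]
  · rw [Real.sign_of_pos h, abs_of_pos h, one_mul]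

theorem funB_eq (β : ℝ) {c ν : ℝ} (hc : 0 < c) (hν : 0 < ν) (t : ℝ) :
    funB β c ν t = β * (2 * Gamma ((ν + 1) / 2) / (√π * Gamma (ν / 2))) *
      sinInt ((ν + 1) / 2) (2 * c * √ν * t) := by
  have hpi : 0 < √π := sqrt_pos.2 pi_pos
  have hG1 := Gamma_pos_of_pos (by positivity : 0 < (ν + 1) / 2)
  have hG2 := Gamma_pos_of_pos (half_pos hν)
  rw [sinInt_mul_eq_sign_mul]
  rcases eq_or_ne t 0 with rfl | ht
  -- In both branches of the definition `Real.sign 0 = 0` gives the value `0`.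
  · simp [funB, funBOdd, funBGeneric]
  have hx : 0 < 2 * c * √ν * |t| := by
    have := abs_pos.2 ht
    have := sqrt_pos.2 hν
    positivity
  rw [funB]
  split_ifs with hodd
  · obtain ⟨n, hn, rfl⟩ := hodd
    have hn2 : (2 * (n : ℝ) - 1 + 1) / 2 = n := by ring
    rw [hn2, Nat.floor_natCast, sinInt_natCast hn hx, funBOdd]
    simp only [hn2]
    ring
  · have hcos : cos (π * ν / 2) ≠ 0 := by
      intro h0
      obtain ⟨k, hk⟩ := cos_eq_zero_iff.1 h0
      have hk' : ν = 2 * k + 1 := by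
        have : π * ν = π * (2 * k + 1) := by linarith
        exact mul_left_cancel₀ pi_ne_zero this
      have hk0 : 0 ≤ k := by
        by_contra! h
        have : (k : ℝ) ≤ -1 := by exact_mod_cast Int.le_sub_one_of_lt h
        linarith
      lift k to ℕ using hk0
      refine hodd ⟨k + 1, by omega, ?_⟩
      push_cast at hk' ⊢
      linarith
    rw [sinInt_eq_besselI_sub_struveL hν hodd hx, funBGeneric,
      show 2 * c * √ν * |t| / 2 = c * √ν * |t| by ring]
    field_simp

/-! ### The characteristic function -/

theorem integral_cexp_mul_one_add_sq_rpow_neg {a : ℝ} (ha : 1 / 2 < a) (x : ℝ) :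
    ∫ u in Ioi (0 : ℝ), Complex.exp (Complex.I * (x * u : ℝ)) * ((1 + u ^ 2) ^ (-a) : ℝ) =
      (cosInt a x : ℂ) + Complex.I * (sinInt a x : ℂ) := by
  have hc : IntegrableOn (fun u => ((cos (x * u) * (1 + u ^ 2) ^ (-a) : ℝ) : ℂ)) (Ioi 0) :=
    (integrable_mul_one_add_sq_rpow_neg ha (φ := fun u => cos (x * u)) (by fun_prop)
      fun u => abs_cos_le_one _).integrableOn.ofReal
  have hs : IntegrableOn (fun u => ((sin (x * u) * (1 + u ^ 2) ^ (-a) : ℝ) : ℂ)) (Ioi 0) :=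
    (integrable_mul_one_add_sq_rpow_neg ha (φ := fun u => sin (x * u)) (by fun_prop)
      fun u => abs_sin_le_one _).integrableOn.ofReal
  rw [cosInt, sinInt, ← integral_complex_ofReal, ← integral_complex_ofReal, ← integral_const_mul,
    ← integral_add hc (hs.const_mul _)]
  congr 1
  funext u
  rw [mul_comm Complex.I, Complex.exp_mul_I]
  push_cast
  ring

theorem integral_Ioi_eq_mul_integral_comp_add_mul (g : ℝ → ℂ) (μ : ℝ) {r : ℝ} (hr : 0 < r) :
    ∫ y in Ioi μ, g y = r * ∫ u in Ioi (0 : ℝ), g (μ + r * u) := by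
  have h1 := integral_comp_mul_left_Ioi' (fun y => g (μ + y)) 0 hr
  rw [mul_zero, Complex.real_smul] at h1
  rw [h1, ← integral_indicator measurableSet_Ioi, ← integral_indicator measurableSet_Ioi,
    ← integral_add_left_eq_self _ μ]
  congr 1
  funext y
  simp [indicator]

theorem integral_Iic_eq_mul_integral_comp_sub_mul (g : ℝ → ℂ) (μ : ℝ) {r : ℝ} (hr : 0 < r) :
    ∫ y in Iic μ, g y = r * ∫ u in Ioi (0 : ℝ), g (μ - r * u) := by
  rw [← neg_neg μ, ← integral_comp_neg_Ioi, neg_neg,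
    integral_Ioi_eq_mul_integral_comp_add_mul (fun y => g (-y)) (-μ) hr]
  congr 2
  funext u
  congr 1
  ring

theorem tConst_pos {ν : ℝ} (hν : 0 < ν) : 0 < tConst ν := by
  have hG1 := Gamma_pos_of_pos (by positivity : 0 < (ν + 1) / 2)
  have hG2 := Gamma_pos_of_pos (half_pos hν)
  have := pi_pos
  rw [tConst]
  positivity

/-- The left side is the Jacobian factor of a rescaled half of the density, up to its weight; the
right side is the prefactor in `funA_eq` and `funB_eq`. -/
theorem two_mul_tConst_mul_sqrt {ν : ℝ} (hν : 0 < ν) :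
    2 * tConst ν * √ν = 2 * Gamma ((ν + 1) / 2) / (√π * Gamma (ν / 2)) := by
  have hG2 := Gamma_pos_of_pos (half_pos hν)
  have := sqrt_pos.2 pi_pos
  have := sqrt_pos.2 hν
  rw [tConst, sqrt_mul pi_pos.le]
  field_simp

/-- The density along one tail, in the rescaled variable. -/
theorem tail_density_eq {β ν σ : ℝ} (hβ : 0 < β) (hν : 0 < ν) (hσ : 0 < σ) (u : ℝ) :
    (1 + 1 / ν * (2 * β * σ * tConst ν * √ν * u / (2 * β * σ * tConst ν)) ^ 2) ^ (-(ν + 1) / 2) =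
      (1 + u ^ 2) ^ (-((ν + 1) / 2)) := by
  have := tConst_pos hν
  rw [neg_div]
  congr 2
  rw [mul_assoc _ √ν u, mul_div_cancel_left₀ _ (by positivity), mul_pow, sq_sqrt hν.le]
  field_simp

theorem integral_Ioi_density {α ν₁ ν₂ σ : ℝ} (hα₁ : α < 1) (hν₂ : 0 < ν₂)
    (hσ : 0 < σ) (μ t : ℝ) :
    ∫ y in Ioi μ, (density α ν₁ ν₂ μ σ y : ℂ) * Complex.exp (Complex.I * t * y) =
      Complex.exp (Complex.I * μ * t) *
        (((1 - α) * (2 * tConst ν₂ * √ν₂) : ℝ) *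
          (cosInt ((ν₂ + 1) / 2) (2 * (1 - α) * σ * tConst ν₂ * √ν₂ * t) +
            Complex.I * sinInt ((ν₂ + 1) / 2) (2 * (1 - α) * σ * tConst ν₂ * √ν₂ * t))) := by
  have hβ : 0 < 1 - α := by linarith
  have hr : 0 < 2 * (1 - α) * σ * tConst ν₂ * √ν₂ := by
    have := tConst_pos hν₂
    have := sqrt_pos.2 hν₂
    positivity
  rw [integral_Ioi_eq_mul_integral_comp_add_mul _ μ hr,
    ← integral_cexp_mul_one_add_sq_rpow_neg (by linarith : 1 / 2 < (ν₂ + 1) / 2),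
    ← integral_const_mul, ← integral_const_mul, ← integral_const_mul]
  refine setIntegral_congr_fun measurableSet_Ioi fun u (hu : 0 < u) => ?_
  have hlt : ¬ μ + 2 * (1 - α) * σ * tConst ν₂ * √ν₂ * u ≤ μ := by
    have := mul_pos hr hu
    linarith
  simp only [density, if_neg hlt]
  rw [add_sub_cancel_left, tail_density_eq hβ hν₂ hσ]
  have he : Complex.I * t * ((μ + 2 * (1 - α) * σ * tConst ν₂ * √ν₂ * u : ℝ) : ℂ) =
      Complex.I * μ * t + Complex.I * ((2 * (1 - α) * σ * tConst ν₂ * √ν₂ * t * u : ℝ) : ℂ) := by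
    push_cast
    ring
  have hσ' : (σ : ℂ) ≠ 0 := Complex.ofReal_ne_zero.2 hσ.ne'
  rw [he, Complex.exp_add]
  simp only [Complex.ofReal_mul, Complex.ofReal_div, Complex.ofReal_one]
  field_simp

theorem integral_Iic_density {α ν₁ ν₂ σ : ℝ} (hα₀ : 0 < α) (hν₁ : 0 < ν₁)
    (hσ : 0 < σ) (μ t : ℝ) :
    ∫ y in Iic μ, (density α ν₁ ν₂ μ σ y : ℂ) * Complex.exp (Complex.I * t * y) =
      Complex.exp (Complex.I * μ * t) *
        ((α * (2 * tConst ν₁ * √ν₁) : ℝ) *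
          (cosInt ((ν₁ + 1) / 2) (2 * α * σ * tConst ν₁ * √ν₁ * t) -
            Complex.I * sinInt ((ν₁ + 1) / 2) (2 * α * σ * tConst ν₁ * √ν₁ * t))) := by
  have hr : 0 < 2 * α * σ * tConst ν₁ * √ν₁ := by
    have := tConst_pos hν₁
    have := sqrt_pos.2 hν₁
    positivity
  have hneg : (cosInt ((ν₁ + 1) / 2) (2 * α * σ * tConst ν₁ * √ν₁ * t) -
      Complex.I * sinInt ((ν₁ + 1) / 2) (2 * α * σ * tConst ν₁ * √ν₁ * t) : ℂ) =
      cosInt ((ν₁ + 1) / 2) (-(2 * α * σ * tConst ν₁ * √ν₁ * t)) +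
      Complex.I * sinInt ((ν₁ + 1) / 2) (-(2 * α * σ * tConst ν₁ * √ν₁ * t)) := by
    rw [cosInt_neg, sinInt_neg]
    push_cast
    ring
  rw [integral_Iic_eq_mul_integral_comp_sub_mul _ μ hr, hneg,
    ← integral_cexp_mul_one_add_sq_rpow_neg (by linarith : 1 / 2 < (ν₁ + 1) / 2),
    ← integral_const_mul, ← integral_const_mul, ← integral_const_mul]
  refine setIntegral_congr_fun measurableSet_Ioi fun u (hu : 0 < u) => ?_
  have hle : μ - 2 * α * σ * tConst ν₁ * √ν₁ * u ≤ μ := by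
    have := mul_pos hr hu
    linarith
  simp only [density, if_pos hle]
  rw [sub_sub_cancel_left, neg_div, neg_sq, tail_density_eq hα₀ hν₁ hσ]
  have he : Complex.I * t * ((μ - 2 * α * σ * tConst ν₁ * √ν₁ * u : ℝ) : ℂ) =
      Complex.I * μ * t + Complex.I * ((-(2 * α * σ * tConst ν₁ * √ν₁ * t) * u : ℝ) : ℂ) := by
    push_cast
    ring
  have hσ' : (σ : ℂ) ≠ 0 := Complex.ofReal_ne_zero.2 hσ.ne'
  rw [he, Complex.exp_add]
  simp only [Complex.ofReal_mul, Complex.ofReal_div, Complex.ofReal_one]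
  field_simp

theorem density_nonneg {σ : ℝ} (hσ : 0 < σ) {ν₁ ν₂ : ℝ} (hν₁ : 0 < ν₁) (hν₂ : 0 < ν₂)
    (α μ y : ℝ) : 0 ≤ density α ν₁ ν₂ μ σ y := by
  rw [density]
  split_ifs <;> positivity

end AST

/-- Continuity at `0` expresses the limit claim, because `funA` takes the value `β` there. -/
theorem mainTheorem4 {Ω : Type*} [MeasurableSpace Ω] (P : Measure Ω) [IsProbabilityMeasure P]
    (Y : Ω → ℝ) (α ν₁ ν₂ μ σ : ℝ) (hα₀ : 0 < α) (hα₁ : α < 1) (hν₁ : 0 < ν₁) (hν₂ : 0 < ν₂)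
    (hσ : 0 < σ) (hY : HasPDF Y P volume)
    (hpdf : pdf Y P volume =ᵐ[volume] fun y => ENNReal.ofReal (AST.density α ν₁ ν₂ μ σ y)) :
    ContinuousAt (AST.funA α (AST.alphaStar α ν₁ ν₂) ν₁) 0 ∧
    ContinuousAt (AST.funA (1 - α) (1 - AST.alphaStar α ν₁ ν₂) ν₂) 0 ∧
    ∀ t : ℝ,
      ∫ ω, Complex.exp (Complex.I * (t : ℂ) * (Y ω : ℂ)) ∂P =
        Complex.exp (Complex.I * (μ : ℂ) * (t : ℂ)) *
          ((AST.funA α (AST.alphaStar α ν₁ ν₂) ν₁ (σ * AST.scaleB α ν₁ ν₂ * t) : ℂ) +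
            (AST.funA (1 - α) (1 - AST.alphaStar α ν₁ ν₂) ν₂ (σ * AST.scaleB α ν₁ ν₂ * t) : ℂ) +
            Complex.I *
              ((AST.funB (1 - α) (1 - AST.alphaStar α ν₁ ν₂) ν₂
                  (σ * AST.scaleB α ν₁ ν₂ * t) : ℂ) -
                (AST.funB α (AST.alphaStar α ν₁ ν₂) ν₁
                  (σ * AST.scaleB α ν₁ ν₂ * t) : ℂ))) := by
  have hβ : 0 < 1 - α := by linarith
  have hK₁ := AST.tConst_pos hν₁
  have hK₂ := AST.tConst_pos hν₂
  have hB : 0 < AST.scaleB α ν₁ ν₂ := by rw [AST.scaleB]; positivity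
  have hs₁ : AST.alphaStar α ν₁ ν₂ = α * AST.tConst ν₁ / AST.scaleB α ν₁ ν₂ := rfl
  have hs₂ : 1 - AST.alphaStar α ν₁ ν₂ = (1 - α) * AST.tConst ν₂ / AST.scaleB α ν₁ ν₂ := by
    rw [hs₁, eq_div_iff hB.ne', sub_mul, div_mul_cancel₀ _ hB.ne', AST.scaleB]
    ring
  have hc₁ : 0 < AST.alphaStar α ν₁ ν₂ := by rw [hs₁]; positivity
  have hc₂ : 0 < 1 - AST.alphaStar α ν₁ ν₂ := by rw [hs₂]; positivity
  refine ⟨AST.continuousAt_funA _ hc₁ hν₁, AST.continuousAt_funA _ hc₂ hν₂, fun t => ?_⟩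
  have harg₁ : 2 * AST.alphaStar α ν₁ ν₂ * √ν₁ * (σ * AST.scaleB α ν₁ ν₂ * t) =
      2 * α * σ * AST.tConst ν₁ * √ν₁ * t := by
    rw [hs₁]; field_simp
  have harg₂ : 2 * (1 - AST.alphaStar α ν₁ ν₂) * √ν₂ * (σ * AST.scaleB α ν₁ ν₂ * t) =
      2 * (1 - α) * σ * AST.tConst ν₂ * √ν₂ * t := by
    rw [hs₂]; field_simp
  have hexpm : AEStronglyMeasurable (fun y : ℝ => Complex.exp (Complex.I * t * y)) volume := by
    fun_prop
  have hYm : AEMeasurable Y P := hY.aemeasurable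
  have hPint : Integrable (fun ω => Complex.exp (Complex.I * t * Y ω)) P := by
    refine Integrable.of_bound (C := 1) ?_ (ae_of_all _ fun ω => ?_)
    · exact AEMeasurable.aestronglyMeasurable (by fun_prop)
    · rw [Complex.norm_exp]
      simp
  have hae : (fun y => (pdf Y P volume y).toReal • Complex.exp (Complex.I * t * y)) =ᵐ[volume]
      fun y => (AST.density α ν₁ ν₂ μ σ y : ℂ) * Complex.exp (Complex.I * t * y) := by
    filter_upwards [hpdf] with y hy
    rw [hy, ENNReal.toReal_ofReal (AST.density_nonneg hσ hν₁ hν₂ _ _ _), Complex.real_smul]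
  -- Integrability is transferred from the bounded exponential under `P`, so the total mass of the
  -- density need not be computed.
  have hint : Integrable fun y =>
      (AST.density α ν₁ ν₂ μ σ y : ℂ) * Complex.exp (Complex.I * t * y) :=
    Integrable.congr ((pdf.integrable_pdf_smul_iff hexpm).2 hPint) hae
  have hlotus : ∫ y, (pdf Y P volume y).toReal • Complex.exp (Complex.I * t * y) =
      ∫ ω, Complex.exp (Complex.I * t * Y ω) ∂P := pdf.integral_pdf_smul hexpm
  rw [← hlotus, integral_congr_ae hae,
    ← intervalIntegral.integral_Iic_add_Ioi (b := μ) hint.integrableOn hint.integrableOn,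
    AST.integral_Iic_density hα₀ hν₁ hσ, AST.integral_Ioi_density hα₁ hν₂ hσ,
    AST.funA_eq α hc₁ hν₁, AST.funA_eq (1 - α) hc₂ hν₂, AST.funB_eq α hc₁ hν₁,
    AST.funB_eq (1 - α) hc₂ hν₂, harg₁, harg₂, AST.two_mul_tConst_mul_sqrt hν₁,
    AST.two_mul_tConst_mul_sqrt hν₂]
  push_cast
  ring
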